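/- Let $\Sigma=\{0,1\}$, let $T$ be the left shift on $\Sigma^\infty$, let $C_w$ be the cylinder of sequences with prefix $w$, and let $v(x)=\sum_{i\ge 0}x_i2^{-(i+1)} \bmod 1$. For finite words $u,w$ let $P(u,w)$ be the number of positions at which $w$ occurs in $u$, divided by $|u|-|w|+1$, and put $H_l(u)=-\frac1l\sum_{|w|=l}P(u,w)\log_2P(u,w)$. For $x\in\Sigma^\infty$ let $$\dim_{FS}(x)=\inf_{l\ge1}\liminf_{n\to\infty}H_l(x_0\dots x_{n-1}),\qquad \mathrm{Dim}_{FS}(x)=\inf_{l\ge1}\limsup_{n\to\infty}H_l(x_0\dots x_{n-1}).$$ For a probability measure $\mu$ on $\Sigma^\infty$ let $\mathbf H_n(\mu)=-\sum_{|w|=n}\mu(C_w)\log_2\mu(C_w)$, $H^+(\mu)=\limsup_n \mathbf H_n(\mu)/n$ and $H^-(\mu)=\liminf_n\mathbf H_n(\mu)/n$. For each $l$ fix any ordering $\mathbf p_1,\dots,\mathbf p_{2^l}$ of $\Sigma^l$. For real $M>0$ let $\mathbf p_{l,M}=\mathbf p_1^{\lceil M\mu(C_{\mathbf p_1})\rceil}\cdots\mathbf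 p_{2^l}^{\lceil M\mu(C_{\mathbf p_{2^l}})\rceil}$. Given sequences $(M_i)_{i\ge1}$ of positive reals and $(\ell_i)_{i\ge1}$ of positive integers, consider the infinite concatenation $$\mathbf p_{1,M_1}^{\ell_1}\,\mathbf p_{2,M_2}^{\ell_2}\,\mathbf p_{3,M_3}^{\ell_3}\cdots.\tag{$*$}$$ **Part 1.** Let $\alpha\in[0,1]$ and let $\mu$ be a $T$-invariant probability measure on $\Sigma^\infty$ with $H^+(\mu)=H^-(\mu)=\alpha$. Let $\log$ be the logarithm to any fixed base $b>1$ and let $x_\mu$ be the sequence $(*)$ with $$M_i=\Big\lceil\max\big\{i^{2i}\log i,\ (\min\{\mu(C_w): |w|=i,\ \mu(C_w)>0\})^{-1}\big\}\Big\rceil,\qquad \ell_1=1,$$ $$\ell_i=\Big\lceil\log i\cdot\max\Big\{\tfrac{M_{i+1}+(i+1)^{i+1}}{M_i},\ \tfrac{M_{i-1}+(i-1)^{i-1}}{M_i}\cdot i\,\ell_{i-1}\Big\}\Big\rceil\quad(i\ge2).$$ Then $\dim_{FS}(x_\mu)=\mathrm{Dim}_{FS}(x_\mu)=\alpha$, and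 for every $k\in\mathbb Z$ $$\lim_{n\to\infty}\frac1n\sum_{j=0}^{n-1}e^{2\pi i k\,v(T^jx_\mu)}=\int e^{2\pi i k\,v(y)}\,d\mu(y).$$ **Part 2.** Let $\alpha\in[0,1]$ be a computable real. There is $p\in[0,1]$ with $-p\log_2p-(1-p)\log_2(1-p)=\alpha$, and every such $p$ is computable. For every such $p$ let $\mu$ be the Bernoulli measure with bias $p$ (the law of i.i.d. digits equal to $1$ with probability $p$), and let $x_\mu$ be the sequence $(*)$ with $M_i=\min\{p,1-p\}^{-2i}$ and $\ell_i=i^{2i}$, where the minimum is taken over the positive ones among $p$ and $1-p$ (so that $M_i=1$ if $p\in\{0,1\}$). Then $x_\mu$ is a computable sequence provided that the chosen orderings of $\Sigma^l$ are computable uniformly in $l$ (for example lexicographic). Moreover, for all orderings, $\dim_{FS}(x_\mu)=\mathrm{Dim}_{FS}(x_\mu)=\alpha$ and $\lim_{n\to\infty}\frac1n\sum_{j=0}^{n-1}e^{2\pi i k\,v(T^jx_\mu)}=\int e^{2\pi i k\,v(y)}\,d\mu(y)$ for every $k\in\mathbb Z$. -/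

import Mathlib

open MeasureTheory Filter Topology

noncomputable section

namespace FSDim

/-! ### Binary sequences, words and cylinders -/

/-- Infinite binary sequences `x₀x₁x₂…`, with the product σ-algebra (which is generated by the
cylinder sets); `false` is the digit `0` and `true` is the digit `1`. -/
abbrev BinSeq : Type := ℕ → Bool

/-- The numerical value of a binary digit. -/
def digit (b : Bool) : ℝ := if b then 1 else 0

/-- The left shift `x₀x₁x₂… ↦ x₁x₂x₃…`. -/
def shift (x : BinSeq) : BinSeq := fun n => x (n + 1)

/-- The prefix `x₀ … x_{n-1}` of length `n`. -/
def pre (x : BinSeq) (n : ℕ) : List Bool := (List.range n).map x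

/-- The cylinder of all sequences having the word `w` as a prefix. -/
def cyl (w : List Bool) : Set BinSeq := {x | pre x w.length = w}

/-- The value `∑ xᵢ / 2^(i+1) mod 1` of a sequence, in `[0, 1)`. -/
def val (x : BinSeq) : ℝ := Int.fract (∑' i : ℕ, digit (x i) / 2 ^ (i + 1))

/-- The character `y ↦ exp (2 π i k v(y))` on sequences. -/
def char (k : ℤ) (y : BinSeq) : ℂ :=
  Complex.exp (2 * Real.pi * Complex.I * (k : ℂ) * (val y : ℂ))

/-- The Weyl averages `(1/n) ∑_{j < n} exp (2 π i k v(T^j x))`. -/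
def weylAvg (x : BinSeq) (k : ℤ) (n : ℕ) : ℂ :=
  (1 / (n : ℂ)) * ∑ j ∈ Finset.range n, char k (shift^[j] x)

/-! ### Sliding block entropy and finite-state dimensions -/

/-- The sliding count probability of the word `w` in the word `u`:
the number of positions `i ∈ [0, |u| - |w|]` at which `w` occurs in `u`,
divided by `|u| - |w| + 1` (it is `0` if `|u| < |w|`). -/
def slideProb (u w : List Bool) : ℝ :=
  (((Finset.range (u.length + 1 - w.length)).filter
      (fun i => (u.drop i).take w.length = w)).card : ℝ)
    / ((u.length : ℝ) - w.length + 1)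

/-- The sliding block entropy of block length `l` of the word `u` (with logarithms to base 2). -/
def blockEntropy (l : ℕ) (u : List Bool) : ℝ :=
  -(1 / (l : ℝ)) * ∑ w : Fin l → Bool,
    slideProb u (List.ofFn w) * Real.logb 2 (slideProb u (List.ofFn w))

/-- Finite-state dimension. -/
def dimFS (x : BinSeq) : ℝ :=
  ⨅ l : ℕ+, liminf (fun n : ℕ => blockEntropy l (pre x n)) atTop

/-- Finite-state strong dimension. -/
def strongDimFS (x : BinSeq) : ℝ :=
  ⨅ l : ℕ+, limsup (fun n : ℕ => blockEntropy l (pre x n)) atTop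

/-! ### Average entropies of a measure -/

/-- `𝐇ₙ(μ) = - ∑_{|w| = n} μ(C_w) log₂ μ(C_w)`. -/
def wordEntropy (μ : Measure BinSeq) (n : ℕ) : ℝ :=
  -∑ w : Fin n → Bool, μ.real (cyl (List.ofFn w)) * Real.logb 2 (μ.real (cyl (List.ofFn w)))

/-- Upper average entropy `H⁺(μ)`. -/
def upperEntropy (μ : Measure BinSeq) : ℝ := limsup (fun n : ℕ => wordEntropy μ n / n) atTop

/-- Lower average entropy `H⁻(μ)`. -/
def lowerEntropy (μ : Measure BinSeq) : ℝ := liminf (fun n : ℕ => wordEntropy μ n / n) atTop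

/-! ### The Champernowne-type construction -/

/-- For every `l`, the list `ord l` is an ordering `𝐩₁, …, 𝐩_{2^l}` of the set of words of
length `l`. -/
def IsWordOrdering (ord : ℕ → List (List Bool)) : Prop :=
  ∀ l, (ord l).Nodup ∧ ∀ w : List Bool, w ∈ ord l ↔ w.length = l

/-- The power `w^k`, i.e. `k` copies of the word `w` in a row. -/
def wpow (w : List Bool) (k : ℕ) : List Bool := (List.replicate k w).flatten

/-- `𝐩_{l,M} = 𝐩₁^⌈M μ(𝐩₁)⌉ 𝐩₂^⌈M μ(𝐩₂)⌉ ⋯ 𝐩_{2^l}^⌈M μ(𝐩_{2^l})⌉`. -/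
def weightedBlock (μ : Measure BinSeq) (ord : ℕ → List (List Bool)) (l : ℕ) (M : ℝ) : List Bool :=
  (ord l).flatMap (fun w => wpow w ⌈M * μ.real (cyl w)⌉₊)

/-- The concatenation `𝐩_{1,M₁}^ℓ₁ 𝐩_{2,M₂}^ℓ₂ ⋯ 𝐩_{k,M_k}^ℓ_k`. -/
def champWord (μ : Measure BinSeq) (ord : ℕ → List (List Bool)) (M : ℕ → ℝ) (ℓ : ℕ → ℕ)
    (k : ℕ) : List Bool :=
  (List.range k).flatMap (fun j => wpow (weightedBlock μ ord (j + 1) (M (j + 1))) (ℓ (j + 1)))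

/-- The infinite concatenation `𝐩_{1,M₁}^ℓ₁ 𝐩_{2,M₂}^ℓ₂ 𝐩_{3,M₃}^ℓ₃ ⋯`. When `μ` is a probability
measure and all `Mᵢ`, `ℓᵢ` with `i ≥ 1` are positive, none of the factors is empty, so
the digit at position `n` already occurs in the product of the first `n + 1` factors. -/
def champSeq (μ : Measure BinSeq) (ord : ℕ → List (List Bool)) (M : ℕ → ℝ) (ℓ : ℕ → ℕ) : BinSeq :=
  fun n => (champWord μ ord M ℓ (n + 1)).getD n false

/-- The least positive `μ`-measure of a cylinder of a word of length `l`. -/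
def minPos (μ : Measure BinSeq) (l : ℕ) : ℝ :=
  sInf {r : ℝ | 0 < r ∧ ∃ w : List Bool, w.length = l ∧ μ.real (cyl w) = r}

/-- `Mᵢ = ⌈max {i^{2i} log i, (min {μ(C_w) : |w| = i, μ(C_w) > 0})⁻¹}⌉`, with logarithm to
base `b`. -/
def champM (b : ℝ) (μ : Measure BinSeq) (i : ℕ) : ℕ :=
  ⌈max ((i : ℝ) ^ (2 * i) * Real.logb b i) (minPos μ i)⁻¹⌉₊

/-- `ℓ₁ = 1` and, for `i ≥ 2`, `ℓᵢ` is the least integer that is at least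
`log i · max {(M_{i+1} + (i+1)^{i+1}) / Mᵢ, (M_{i-1} + (i-1)^{i-1}) / Mᵢ · i ℓ_{i-1}}`,
with logarithm to base `b` (the value at `0` is not used). -/
def champRep (b : ℝ) (μ : Measure BinSeq) : ℕ → ℕ
  | 0 => 1
  | 1 => 1
  | j + 2 =>
    ⌈Real.logb b ((j + 2 : ℕ) : ℝ) *
      max (((champM b μ (j + 3) : ℝ) + ((j + 3 : ℕ) : ℝ) ^ (j + 3)) / (champM b μ (j + 2) : ℝ))
        (((champM b μ (j + 1) : ℝ) + ((j + 1 : ℕ) : ℝ) ^ (j + 1)) / (champM b μ (j + 2) : ℝ)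
          * (((j + 2 : ℕ) : ℝ) * (champRep b μ (j + 1) : ℝ)))⌉₊

/-- The Champernowne sequence `x_μ` for `μ`, built with the orderings `ord` and with logarithms to
base `b`. -/
def champernowne (b : ℝ) (μ : Measure BinSeq) (ord : ℕ → List (List Bool)) : BinSeq :=
  champSeq μ ord (fun i => (champM b μ i : ℝ)) (champRep b μ)

/-! ### Bernoulli measures and their Champernowne sequences -/

/-- The law of an i.i.d. sequence of digits, each equal to `1` with probability `p`. -/
def bernoulliSeq (p : unitInterval) : Measure BinSeq :=
  Measure.infinitePi (fun _ : ℕ => ProbabilityTheory.bernoulliMeasure true false p)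

/-- The smallest positive element of `{p, 1 - p}`, so `min {p, 1 - p}` for `0 < p < 1`
and `1` for `p ∈ {0, 1}`. -/
def minBias (p : ℝ) : ℝ := sInf {r : ℝ | 0 < r ∧ (r = p ∨ r = 1 - p)}

/-- The Champernowne sequence for the Bernoulli measure with bias `p`, built with
`Mᵢ = min {p, 1 - p}^{-2i}` and `ℓᵢ = i^{2i}`. -/
def bernoulliChampernowne (p : unitInterval) (ord : ℕ → List (List Bool)) : BinSeq :=
  champSeq (bernoulliSeq p) ord (fun i => ((minBias p) ^ (2 * i))⁻¹) (fun i => i ^ (2 * i))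

/-! ### Computable reals -/

/-- `a` is a computable real: some computable `f : ℕ → ℤ` gives dyadic approximations
`f n / 2^n` to `a` with error at most `2^{-n}`. -/
def IsComputableReal (a : ℝ) : Prop :=
  ∃ f : ℕ → ℤ, Computable f ∧ ∀ n : ℕ, |a - (f n : ℝ) / 2 ^ n| ≤ 1 / 2 ^ n

/-- The binary entropy `- p log₂ p - (1 - p) log₂ (1 - p)`. -/
def entropy₂ (p : ℝ) : ℝ := -p * Real.logb 2 p - (1 - p) * Real.logb 2 (1 - p)

end FSDim

end

open FSDim

noncomputable section

namespace FSDim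

/-! ### Occurrences of a word -/

/-! Everything reduces to one property of the constructed sequence: it is generic for `μ`, meaning
that each word `w` occurs with limiting frequency `μ(C_w)` (`IsGeneric`).

Genericity rests on the functional `dev w c u`, the deviation of the number of occurrences of `w` in
`u` from `c |u|`, plus `|w|`. Only occurrences across a seam spoil additivity, and the summand `|w|`
pays for them, so `dev` is exactly subadditive. In a block `𝐩_{l,M}` each word `v` of length `l` is
repeated about `M μ(C_v)` times, so the block imitates a sample from `μ`; by invariance its
deviation is small compared with its length (`dev_weightedBlock_le`). Long powers inherit this, and
a prefix that stops inside a copy loses at most one block, which is short compared with the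
preceding power (`exists_powConcat_take_le`). Hence `isGeneric_champSeq`.

For a generic sequence every sliding block entropy converges to `𝐇_l(μ)/l`, so the two dimensions
agree. Invariance makes `𝐇_l(μ)` subadditive, and Fekete's lemma identifies the infimum of
`𝐇_l(μ)/l` with the average entropy (`IsGeneric.dim_eq_upperEntropy`). The characters are uniform
limits of functions of finitely many digits, which gives the Weyl averages
(`IsGeneric.tendsto_weylAvg`).

Computability has two ingredients. A bias `p` is recovered from its entropy by searching for dyadic
neighbours on which the strictly monotone entropy is certified to lie strictly on the correct side;
at rational points this is an integer inequality. The ceilings `⌈m⁻ˢ(1-m)ᵗ⌉`, with `m` the smaller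
bias, cannot be found by approximation alone, since the number may be an integer. However, the
exponents with rational value form a subgroup of `ℤ²` with two generators, so finitely many fixed
fractions settle the rational values exactly (`exists_computable_ceil`). -/

/-- The number of positions of `u` at which the word `w` occurs. -/
def occ (w : List Bool) : List Bool → ℕ
  | [] => 0
  | a :: u => (if w <+: a :: u then 1 else 0) + occ w u

lemma occ_append_ge (w u v : List Bool) : occ w u + occ w v ≤ occ w (u ++ v) := by
  induction u with
  | nil => simp [occ]
  | cons a u ih =>
    have h : w <+: a :: u → w <+: a :: (u ++ v) := fun h => h.trans ⟨v, by simp⟩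
    simp only [occ, List.cons_append]
    by_cases h1 : w <+: a :: u
    · simp only [h1, h h1, if_true]; omega
    · simp only [h1, if_false]; omega

/-- An occurrence across the seam starts in the last `|w|` letters of `u`. The `min` makes the
induction close: it grows with `u` only while `u` is shorter than `w`, and afterwards a new
occurrence at the front fits inside `u`. -/
lemma occ_append_le_min (w u v : List Bool) :
    occ w (u ++ v) ≤ occ w u + occ w v + min u.length w.length := by
  induction u with
  | nil => simp [occ]
  | cons a u ih =>
    simp only [occ, List.cons_append, List.length_cons]
    by_cases hl : w.length ≤ u.length + 1
    · have h : w <+: a :: (u ++ v) → w <+: a :: u := fun h =>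
        List.prefix_of_prefix_length_le h (⟨v, by simp⟩ : a :: u <+: a :: (u ++ v)) (by simpa)
      by_cases h1 : w <+: a :: (u ++ v)
      · simp only [h1, h h1, if_true]; omega
      · simp only [h1, if_false]; omega
    · split_ifs <;> omega

lemma occ_append_le (w u v : List Bool) :
    occ w (u ++ v) ≤ occ w u + occ w v + w.length :=
  (occ_append_le_min w u v).trans (by omega)

lemma occ_le_length (w u : List Bool) : occ w u ≤ u.length := by
  induction u with
  | nil => simp [occ]
  | cons a u ih => simp only [occ, List.length_cons]; split_ifs <;> omega

/-! ### Shifts and prefixes -/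

lemma shift_iterate_apply (x : BinSeq) (j n : ℕ) : (shift^[j] x) n = x (n + j) := by
  induction j generalizing x with
  | zero => rfl
  | succ j ih => rw [Function.iterate_succ_apply, ih]; simp [shift, add_assoc]

@[simp] lemma pre_length (x : BinSeq) (n : ℕ) : (pre x n).length = n := by simp [pre]

lemma pre_succ_cons (x : BinSeq) (n : ℕ) : pre x (n + 1) = x 0 :: pre (shift x) n := by
  simp [pre, List.range_succ_eq_map, shift, Function.comp_def]

lemma pre_take (x : BinSeq) {m n : ℕ} (h : m ≤ n) : (pre x n).take m = pre x m := by
  apply List.ext_getElem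
  · simpa using h
  · intro i h1 h2
    simp [pre]

lemma pre_drop (x : BinSeq) (i n : ℕ) : (pre x (i + n)).drop i = pre (shift^[i] x) n := by
  apply List.ext_getElem
  · simp
  · intro j h1 h2
    simp [pre, shift_iterate_apply, add_comm]

lemma pre_append (x : BinSeq) (m n : ℕ) : pre x (m + n) = pre x m ++ pre (shift^[m] x) n := by
  rw [← pre_drop, ← pre_take x (Nat.le_add_right m n), List.take_append_drop]

lemma mem_cyl (x : BinSeq) (w : List Bool) : x ∈ cyl w ↔ pre x w.length = w := Iff.rfl

lemma prefix_pre_iff (x : BinSeq) (w : List Bool) (n : ℕ) :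
    w <+: pre x n ↔ w.length ≤ n ∧ x ∈ cyl w := by
  rw [List.prefix_iff_eq_take, mem_cyl]
  constructor
  · intro h
    have h1 : w.length ≤ n := by
      have := congrArg List.length h
      simp at this; omega
    exact ⟨h1, by rw [← pre_take x h1]; exact h.symm⟩
  · rintro ⟨h1, h2⟩
    rw [pre_take x h1, h2]

open Classical in
/-- The number of `j < n` such that `T^j x` lies in the cylinder of `w`. -/
def visits (x : BinSeq) (w : List Bool) (n : ℕ) : ℕ :=
  ((Finset.range n).filter fun j => shift^[j] x ∈ cyl w).card

open Classical in
lemma visits_eq_sum (x : BinSeq) (w : List Bool) (n : ℕ) :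
    visits x w n = ∑ j ∈ Finset.range n, if shift^[j] x ∈ cyl w then 1 else 0 := by
  rw [visits, Finset.card_filter]

open Classical in
lemma visits_succ (x : BinSeq) (w : List Bool) (n : ℕ) :
    visits x w (n + 1) = (if x ∈ cyl w then 1 else 0) + visits (shift x) w n := by
  rw [visits_eq_sum, visits_eq_sum, Finset.sum_range_succ', add_comm]
  simp only [Function.iterate_succ_apply, Function.iterate_zero, id]
  congr!

lemma occ_pre_le_visits (x : BinSeq) (w : List Bool) (n : ℕ) :
    occ w (pre x n) ≤ visits x w n := by
  induction n generalizing x with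
  | zero => simp [pre, occ]
  | succ n ih =>
    rw [visits_succ, pre_succ_cons, occ, ← pre_succ_cons]
    gcongr
    · split_ifs with h1 h2 <;> simp_all [prefix_pre_iff]
    · exact ih _

/-- Only the last `|w|` starting positions can give an occurrence that runs past the prefix. -/
lemma visits_le_occ_pre (x : BinSeq) (w : List Bool) (n : ℕ) :
    visits x w n ≤ occ w (pre x n) + w.length := by
  suffices h : visits x w n ≤ occ w (pre x n) + min n w.length by omega
  induction n generalizing x with
  | zero => simp [visits]
  | succ n ih =>
    rw [visits_succ, pre_succ_cons, occ, ← pre_succ_cons]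
    have := ih (shift x)
    have hp := prefix_pre_iff x w (n + 1)
    split_ifs with hx h2
    · omega
    · have : ¬ w.length ≤ n + 1 := fun h => h2 (hp.2 ⟨h, hx⟩)
      omega
    all_goals omega

/-- The sliding block probabilities of the prefixes are visit frequencies. -/
lemma slideProb_pre (x : BinSeq) (w : List Bool) {n : ℕ} (h : w.length ≤ n) :
    slideProb (pre x n) w = (visits x w (n + 1 - w.length) : ℝ) / ((n + 1 - w.length : ℕ) : ℝ) := by
  unfold slideProb visits
  congr 1
  · simp only [pre_length]
    congr 2
    ext i
    simp only [Finset.mem_filter, Finset.mem_range, and_congr_right_iff]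
    intro hi
    obtain ⟨k, rfl⟩ : ∃ k, n = i + k := ⟨n - i, by omega⟩
    rw [pre_drop, pre_take _ (by omega), mem_cyl]
  · rw [pre_length, Nat.cast_sub (by omega)]; push_cast; ring

/-! ### Subadditive functionals along concatenations of powers -/

/-- The deviation of the number of occurrences of `w` in `u` from `c |u|`, plus `|w|`. -/
def dev (w : List Bool) (c : ℝ) (u : List Bool) : ℝ :=
  |(occ w u : ℝ) - c * u.length| + w.length

/-- Each side carries one `|w|`, and the spare one on the right covers the occurrences across the
seam. -/
lemma dev_append_le (w : List Bool) (c : ℝ) (u v : List Bool) :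
    dev w c (u ++ v) ≤ dev w c u + dev w c v := by
  unfold dev
  have h1 : (occ w u : ℝ) + occ w v ≤ occ w (u ++ v) := by exact_mod_cast occ_append_ge w u v
  have h2 : (occ w (u ++ v) : ℝ) ≤ occ w u + occ w v + w.length := by
    exact_mod_cast occ_append_le w u v
  have a1 := abs_le.1 (le_refl |(occ w u : ℝ) - c * u.length|)
  have a2 := abs_le.1 (le_refl |(occ w v : ℝ) - c * v.length|)
  have : |(occ w (u ++ v) : ℝ) - c * (u ++ v).length| ≤
      |(occ w u : ℝ) - c * u.length| + |(occ w v : ℝ) - c * v.length| + w.length := by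
    rw [List.length_append, abs_le]
    push_cast
    constructor <;> nlinarith
  linarith

lemma dev_le (w : List Bool) {c : ℝ} (hc : 0 ≤ c) (hc1 : c ≤ 1) (u : List Bool) :
    dev w c u ≤ u.length + w.length := by
  unfold dev
  gcongr
  have h : (occ w u : ℝ) ≤ u.length := by exact_mod_cast occ_le_length w u
  have h0 : (0 : ℝ) ≤ occ w u := by positivity
  have h1 : (0 : ℝ) ≤ u.length := by positivity
  rw [abs_le]
  constructor <;> nlinarith

lemma wpow_succ (u : List Bool) (r : ℕ) : wpow u (r + 1) = u ++ wpow u r := by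
  simp [wpow, List.replicate_succ]

lemma length_wpow (u : List Bool) (r : ℕ) : (wpow u r).length = r * u.length := by
  simp [wpow]

section Subadditive

variable {g : List Bool → ℝ} {m : ℝ}

/-- Complete copies cost `ε` per letter; only the final incomplete copy is charged the trivial bound
`|u| + m`. -/
lemma subadditive_take_wpow (hg : ∀ u v, g (u ++ v) ≤ g u + g v)
    (hgm : ∀ u, g u ≤ u.length + m) {ε : ℝ} (hε : 0 ≤ ε) {u : List Bool} (hu : g u ≤ ε * u.length)
    (r s : ℕ) (hs : s ≤ (wpow u r).length) :
    g ((wpow u r).take s) ≤ ε * s + u.length + m := by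
  induction r generalizing s with
  | zero =>
    refine (hgm _).trans ?_
    have : 0 ≤ ε * s := by positivity
    simp [wpow]; linarith
  | succ r ih =>
    rw [wpow_succ] at hs ⊢
    by_cases h : s ≤ u.length
    · refine (hgm _).trans ?_
      have h1 : (((u ++ wpow u r).take s).length : ℝ) ≤ u.length := by
        exact_mod_cast (List.length_take_le _ _).trans h
      have : 0 ≤ ε * s := by positivity
      linarith
    · push Not at h
      rw [List.take_append, List.take_of_length_le h.le]
      have h1 := ih (s - u.length) (by rw [List.length_append] at hs; omega)
      refine (hg _ _).trans ?_
      rw [Nat.cast_sub h.le] at h1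
      linarith

lemma subadditive_wpow (hg : ∀ u v, g (u ++ v) ≤ g u + g v) {ε : ℝ} {u : List Bool}
    (hu : g u ≤ ε * u.length) (r : ℕ) (v : List Bool) :
    g (v ++ wpow u r) ≤ g v + ε * (wpow u r).length := by
  induction r generalizing v with
  | zero => simp [wpow]
  | succ r ih =>
    rw [wpow_succ, ← List.append_assoc]
    refine (ih _).trans ?_
    have := hg v u
    rw [List.length_append]; push_cast
    linarith

/-- The concatenation `B₀^ℓ₀ ⋯ B_{k-1}^ℓ_{k-1}`. -/
def powConcat (B : ℕ → List Bool) (ℓ : ℕ → ℕ) (k : ℕ) : List Bool :=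
  (List.range k).flatMap fun j => wpow (B j) (ℓ j)

lemma powConcat_succ (B : ℕ → List Bool) (ℓ : ℕ → ℕ) (k : ℕ) :
    powConcat B ℓ (k + 1) = powConcat B ℓ k ++ wpow (B k) (ℓ k) := by
  simp [powConcat, List.range_succ]

/-- One `ε` comes from the complete copies of good blocks, the other from the single incomplete copy
at the end. The constant `C` collects the finitely many bad blocks and must not depend on `k` or
`n`. -/
lemma exists_powConcat_take_le {B : ℕ → List Bool} {ℓ : ℕ → ℕ}
    (hg : ∀ u v, g (u ++ v) ≤ g u + g v) (hm : 0 ≤ m) (hgm : ∀ u, g u ≤ u.length + m)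
    (hB : ∀ ε > 0, ∀ᶠ j in atTop, g (B j) ≤ ε * (B j).length)
    (hl : ∀ ε > 0, ∀ᶠ j in atTop, ((B (j + 1)).length : ℝ) ≤ ε * (ℓ j * (B j).length))
    {ε : ℝ} (hε : 0 < ε) :
    ∃ C : ℝ, ∀ k n, n ≤ (powConcat B ℓ k).length →
      g ((powConcat B ℓ k).take n) ≤ 2 * ε * n + C := by
  obtain ⟨K, hK⟩ := eventually_atTop.1 ((hB ε hε).and (hl ε hε))
  set W := powConcat B ℓ with hW
  have hfull : ∀ k, K ≤ k → g (W k) ≤ ε * (W k).length + ((W K).length + m) := by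
    intro k hk
    induction k, hk using Nat.le_induction with
    | base =>
      have := hgm (W K)
      have h0 : 0 ≤ ε * (W K).length := by positivity
      linarith
    | succ k hk ih =>
      rw [hW, powConcat_succ, ← hW]
      have := subadditive_wpow hg (hK k hk).1 (ℓ k) (W k)
      rw [List.length_append]; push_cast
      linarith
  refine ⟨(W K).length + (W (K + 1)).length + 2 * m, ?_⟩
  -- Prefixes ending before the good range are absorbed by the constant.
  have hsmall : ∀ k n, n ≤ (W (K + 1)).length →
      g ((W k).take n) ≤ 2 * ε * n + ((W K).length + (W (K + 1)).length + 2 * m) := by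
    intro k n hn
    have h1 := hgm ((W k).take n)
    have h2 : (((W k).take n).length : ℝ) ≤ (W (K + 1)).length := by
      exact_mod_cast (List.length_take_le _ _).trans hn
    have h0 : 0 ≤ 2 * ε * n := by positivity
    have h3 : (0 : ℝ) ≤ (W K).length := by positivity
    linarith
  intro k
  induction k with
  | zero => exact fun n hn => hsmall 0 n (hn.trans (by simp [hW, powConcat]))
  | succ k ih =>
    intro n hn
    by_cases hk : k ≤ K
    · refine hsmall _ n (hn.trans ?_)
      obtain ⟨d, hd⟩ : ∃ d, K + 1 = (k + 1) + d := ⟨K - k, by omega⟩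
      rw [hd]
      clear hd hn ih
      induction d with
      | zero => exact le_rfl
      | succ d ihd =>
        refine ihd.trans ?_
        rw [← Nat.add_assoc, hW, powConcat_succ, List.length_append]
        omega
    · by_cases h : n ≤ (W k).length
      · rw [hW, powConcat_succ, ← hW, List.take_append_of_le_length h]
        exact ih n h
      · push Not at h hk
        rw [hW, powConcat_succ, ← hW] at hn ⊢
        rw [List.take_append, List.take_of_length_le h.le]
        have h1 := subadditive_take_wpow hg hgm hε.le (hK k hk.le).1 (ℓ k) (n - (W k).length)
          (by rw [List.length_append] at hn; omega)
        rw [Nat.cast_sub h.le] at h1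
        have h2 := hfull k hk.le
        obtain ⟨k, rfl⟩ : ∃ k', k = k' + 1 := ⟨k - 1, by omega⟩
        have h3 := (hK k (by omega)).2
        -- The power before the current one lies entirely in the prefix, so the current block has
        -- length at most `ε n`.
        have h4 : ((ℓ k : ℝ) * (B k).length) ≤ n := by
          have : ℓ k * (B k).length ≤ n := by
            refine le_trans ?_ h.le
            rw [hW, powConcat_succ, List.length_append, length_wpow]
            omega
          exact_mod_cast this
        have h5 : ε * (ℓ k * (B k).length) ≤ ε * n := by gcongr
        have h6 : (0 : ℝ) ≤ (W (K + 1)).length := by positivity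
        refine (hg _ _).trans ?_
        linarith

end Subadditive

/-! ### Cylinders as preimages under the projections to finitely many digits -/

lemma pre_eq_ofFn (x : BinSeq) (n : ℕ) : pre x n = List.ofFn fun i : Fin n => x i := by
  apply List.ext_getElem
  · simp
  · intro i h1 h2
    simp [pre]

lemma cyl_ofFn {n : ℕ} (v : Fin n → Bool) :
    cyl (List.ofFn v) = (fun (x : BinSeq) (i : Fin n) => x i) ⁻¹' {v} := by
  ext x
  simp only [mem_cyl, List.length_ofFn, pre_eq_ofFn, Set.mem_preimage, Set.mem_singleton_iff]
  exact List.ofFn_injective.eq_iff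

lemma exists_ofFn_eq (w : List Bool) : ∃ v : Fin w.length → Bool, List.ofFn v = w :=
  ⟨w.get, List.ofFn_get w⟩

lemma measurable_proj (n : ℕ) : Measurable fun (x : BinSeq) (i : Fin n) => x i := by
  fun_prop

lemma measurableSet_cyl (w : List Bool) : MeasurableSet (cyl w) := by
  obtain ⟨v, hv⟩ := exists_ofFn_eq w
  rw [← hv, cyl_ofFn]
  exact measurable_proj _ (measurableSet_singleton v)

lemma integral_proj {E : Type*} [NormedAddCommGroup E] [NormedSpace ℝ E] [CompleteSpace E]
    (μ : Measure BinSeq) [IsProbabilityMeasure μ] (n : ℕ) (φ : (Fin n → Bool) → E) :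
    ∫ x, φ (fun i => x i) ∂μ = ∑ v, μ.real (cyl (List.ofFn v)) • φ v := by
  have hm := measurable_proj n
  have := Measure.isProbabilityMeasure_map (μ := μ) hm.aemeasurable
  rw [← integral_map (φ := fun (x : BinSeq) (i : Fin n) => x i) hm.aemeasurable (f := φ)
    (by fun_prop), integral_fintype (Integrable.of_finite)]
  congr 1
  ext v
  rw [cyl_ofFn, measureReal_def, measureReal_def, Measure.map_apply hm (measurableSet_singleton v)]

lemma sum_cyl (μ : Measure BinSeq) [IsProbabilityMeasure μ] (n : ℕ) :
    ∑ v : Fin n → Bool, μ.real (cyl (List.ofFn v)) = 1 := by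
  have := integral_proj μ n (fun _ => (1 : ℝ))
  simpa using this.symm

lemma measureReal_preimage_shift_iterate {μ : Measure BinSeq} (hμ : MeasurePreserving shift μ μ)
    (j : ℕ) (w : List Bool) : μ.real (shift^[j] ⁻¹' cyl w) = μ.real (cyl w) := by
  rw [measureReal_def, (hμ.iterate j).measure_preimage (measurableSet_cyl w).nullMeasurableSet,
    measureReal_def]

lemma integral_visits {μ : Measure BinSeq} [IsProbabilityMeasure μ]
    (hμ : MeasurePreserving shift μ μ) (w : List Bool) (n : ℕ) :
    Integrable (fun x => (visits x w n : ℝ)) μ ∧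
      ∫ x, (visits x w n : ℝ) ∂μ = n * μ.real (cyl w) := by
  classical
  have h : ∀ x, (visits x w n : ℝ) =
      ∑ j ∈ Finset.range n, (shift^[j] ⁻¹' cyl w).indicator (fun _ => (1 : ℝ)) x := by
    intro x
    rw [visits_eq_sum]
    push_cast
    refine Finset.sum_congr rfl fun j _ => ?_
    simp [Set.indicator]
  have hms : ∀ j, MeasurableSet (shift^[j] ⁻¹' cyl w) := fun j =>
    (hμ.iterate j).measurable (measurableSet_cyl w)
  have hi : ∀ j ∈ Finset.range n,
      Integrable ((shift^[j] ⁻¹' cyl w).indicator (fun _ => (1 : ℝ))) μ := fun j _ =>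
    (integrable_const 1).indicator (hms j)
  simp_rw [h]
  refine ⟨integrable_finsetSum _ hi, ?_⟩
  rw [integral_finsetSum _ hi]
  simp_rw [integral_indicator_const (1 : ℝ) (hms _), measureReal_preimage_shift_iterate hμ]
  simp

/-- The sum is the mean of `occ w - μ(C_w) n` over a `μ`-random prefix. By invariance `visits` has
mean exactly `n μ(C_w)`, and it differs from `occ` by at most `|w|` pointwise. -/
lemma abs_sum_occ_sub_le {μ : Measure BinSeq} [IsProbabilityMeasure μ]
    (hμ : MeasurePreserving shift μ μ) (w : List Bool) (n : ℕ) :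
    |∑ v : Fin n → Bool, μ.real (cyl (List.ofFn v)) *
      ((occ w (List.ofFn v) : ℝ) - μ.real (cyl w) * n)| ≤ w.length := by
  have h1 := integral_proj μ n
    (fun v => (occ w (List.ofFn v) : ℝ) - μ.real (cyl w) * n)
  simp only [smul_eq_mul, ← pre_eq_ofFn] at h1
  rw [← h1]
  obtain ⟨hi, hv⟩ := integral_visits hμ w n
  have h2 : ∫ x, ((occ w (pre x n) : ℝ) - μ.real (cyl w) * n) ∂μ =
      ∫ x, ((occ w (pre x n) : ℝ) - visits x w n) ∂μ := by
    have hio : Integrable (fun x => (occ w (pre x n) : ℝ)) μ := by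
      refine Integrable.of_bound (C := n) ?_ (ae_of_all _ fun x => ?_)
      · simp_rw [pre_eq_ofFn]
        exact ((measurable_of_finite
          fun v : Fin n → Bool => (occ w (List.ofFn v) : ℝ)).comp
            (measurable_proj n)).aestronglyMeasurable
      · have := occ_le_length w (pre x n)
        rw [pre_length] at this
        simpa using this
    rw [integral_sub hio (integrable_const _), integral_sub hio hi, hv]
    simp [mul_comm]
  rw [h2]
  have h3 : ∀ x, ‖(occ w (pre x n) : ℝ) - visits x w n‖ ≤ w.length := by
    intro x
    have a1 : (occ w (pre x n) : ℝ) ≤ visits x w n := by exact_mod_cast occ_pre_le_visits x w n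
    have a2 : (visits x w n : ℝ) ≤ occ w (pre x n) + w.length := by
      exact_mod_cast visits_le_occ_pre x w n
    rw [Real.norm_eq_abs, abs_le]
    constructor <;> linarith
  have := norm_integral_le_of_norm_le_const (μ := μ) (ae_of_all _ h3)
  simpa using this

/-! ### Weighted blocks -/

/-- This removes the ordering from all estimates: it affects only the seams, which are bounded
uniformly. -/
lemma IsWordOrdering.sum_map {ord : ℕ → List (List Bool)} (hord : IsWordOrdering ord)
    {A : Type*} [AddCommMonoid A] (l : ℕ) (F : List Bool → A) :
    ((ord l).map F).sum = ∑ v : Fin l → Bool, F (List.ofFn v) := by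
  classical
  obtain ⟨hn, hm⟩ := hord l
  rw [← List.sum_toFinset F hn]
  refine Eq.trans ?_ (Finset.sum_map Finset.univ ⟨List.ofFn, List.ofFn_injective⟩ F)
  congr 1
  ext w
  simp only [List.mem_toFinset, hm, Finset.mem_map, Finset.mem_univ, true_and,
    Function.Embedding.coeFn_mk]
  constructor
  · rintro rfl
    exact exists_ofFn_eq w
  · rintro ⟨v, rfl⟩
    simp

/-- The number of factors of `𝐩_{l,M}`. -/
def ceilTotal (μ : Measure BinSeq) (l : ℕ) (M : ℝ) : ℕ :=
  ∑ v : Fin l → Bool, ⌈M * μ.real (cyl (List.ofFn v))⌉₊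

lemma le_ceilTotal (μ : Measure BinSeq) [IsProbabilityMeasure μ] (l : ℕ) (M : ℝ) :
    M ≤ ceilTotal μ l M := by
  unfold ceilTotal
  push_cast
  calc M = ∑ v : Fin l → Bool, M * μ.real (cyl (List.ofFn v)) := by
        rw [← Finset.mul_sum, sum_cyl, mul_one]
    _ ≤ _ := Finset.sum_le_sum fun v _ => Nat.le_ceil _

lemma ceilTotal_pos (μ : Measure BinSeq) [IsProbabilityMeasure μ] (l : ℕ) {M : ℝ} (hM : 0 < M) :
    0 < ceilTotal μ l M := by
  have := hM.trans_le (le_ceilTotal μ l M)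
  exact_mod_cast this

lemma ceilTotal_le (μ : Measure BinSeq) [IsProbabilityMeasure μ] (l : ℕ) {M : ℝ} (hM : 0 ≤ M) :
    (ceilTotal μ l M : ℝ) ≤ M + 2 ^ l := by
  unfold ceilTotal
  push_cast
  calc ∑ v : Fin l → Bool, (⌈M * μ.real (cyl (List.ofFn v))⌉₊ : ℝ)
      ≤ ∑ v : Fin l → Bool, (M * μ.real (cyl (List.ofFn v)) + 1) :=
        Finset.sum_le_sum fun v _ => (Nat.ceil_lt_add_one (by positivity)).le
    _ = M + 2 ^ l := by
        rw [Finset.sum_add_distrib, ← Finset.mul_sum, sum_cyl]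
        simp

lemma length_weightedBlock {ord : ℕ → List (List Bool)} (hord : IsWordOrdering ord)
    (μ : Measure BinSeq) (l : ℕ) (M : ℝ) :
    (weightedBlock μ ord l M).length = l * ceilTotal μ l M := by
  have h : ∀ w ∈ ord l, (wpow w ⌈M * μ.real (cyl w)⌉₊).length = l * ⌈M * μ.real (cyl w)⌉₊ := by
    intro w hw
    rw [length_wpow, ((hord l).2 w).1 hw, mul_comm]
  rw [weightedBlock, List.length_flatMap, List.map_congr_left h, hord.sum_map, ceilTotal,
    Finset.mul_sum]

lemma abs_occ_wpow_append_le (w : List Bool) (c : ℝ) (u v : List Bool) (r : ℕ) :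
    |((occ w (wpow u r ++ v) : ℝ) - c * (wpow u r ++ v).length) -
      (r * ((occ w u : ℝ) - c * u.length) + (occ w v - c * v.length))| ≤ w.length * r := by
  induction r with
  | zero => simp [wpow]
  | succ r ih =>
    rw [wpow_succ, List.append_assoc]
    have h1 : (occ w u : ℝ) + occ w (wpow u r ++ v) ≤ occ w (u ++ (wpow u r ++ v)) := by
      exact_mod_cast occ_append_ge w _ _
    have h2 : (occ w (u ++ (wpow u r ++ v)) : ℝ) ≤ occ w u + occ w (wpow u r ++ v) + w.length := by
      exact_mod_cast occ_append_le w _ _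
    rw [abs_le] at ih ⊢
    rw [List.length_append (as := u)]
    push_cast
    constructor <;> linarith [ih.1, ih.2]

lemma abs_occ_flatMap_le (w : List Bool) (c : ℝ) (N : List Bool → ℕ) (L : List (List Bool)) :
    |((occ w (L.flatMap fun u => wpow u (N u)) : ℝ) -
        c * (L.flatMap fun u => wpow u (N u)).length) -
      (L.map fun u => (N u : ℝ) * ((occ w u : ℝ) - c * u.length)).sum| ≤
      w.length * (L.map fun u => (N u : ℝ)).sum := by
  induction L with
  | nil => simp [occ]
  | cons u L ih =>
    rw [List.flatMap_cons, List.map_cons, List.map_cons, List.sum_cons, List.sum_cons]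
    have := abs_occ_wpow_append_le w c u (L.flatMap fun u => wpow u (N u)) (N u)
    rw [abs_le] at this ih ⊢
    constructor <;> linarith [ih.1, ih.2, this.1, this.2]

/-- With `S` factors in the block, the errors are `|w|` per seam, `M |w|` from the mean over words,
at most `l` for each unit of rounding excess `S - M`, and the `|w|` built into `dev`. The bounds `M
≤ S` and `1 ≤ S` merge the terms in `|w|`. -/
lemma dev_weightedBlock_le {ord : ℕ → List (List Bool)} (hord : IsWordOrdering ord)
    {μ : Measure BinSeq} [IsProbabilityMeasure μ] (hμ : MeasurePreserving shift μ μ)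
    (w : List Bool) (l : ℕ) {M : ℝ} (hM : 0 < M) :
    dev w (μ.real (cyl w)) (weightedBlock μ ord l M) ≤
      3 * w.length * ceilTotal μ l M + l * (ceilTotal μ l M - M) := by
  set c := μ.real (cyl w) with hc
  set S : ℝ := ((ceilTotal μ l M : ℕ) : ℝ) with hS
  have hc0 : 0 ≤ c := measureReal_nonneg
  have hc1 : c ≤ 1 := measureReal_le_one
  have h1 := abs_occ_flatMap_le w c (fun u => ⌈M * μ.real (cyl u)⌉₊) (ord l)
  rw [hord.sum_map, hord.sum_map] at h1
  have hS' : ∑ v : Fin l → Bool, (⌈M * μ.real (cyl (List.ofFn v))⌉₊ : ℝ) = S := by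
    rw [hS, ceilTotal]; push_cast; rfl
  rw [hS'] at h1
  set D : (Fin l → Bool) → ℝ := fun v => (occ w (List.ofFn v) : ℝ) - c * l with hD
  have h2 : ∑ v : Fin l → Bool, (⌈M * μ.real (cyl (List.ofFn v))⌉₊ : ℝ) *
      ((occ w (List.ofFn v) : ℝ) - c * (List.ofFn v).length) =
      M * ∑ v, μ.real (cyl (List.ofFn v)) * D v +
      ∑ v, ((⌈M * μ.real (cyl (List.ofFn v))⌉₊ : ℝ) - M * μ.real (cyl (List.ofFn v))) * D v := by
    rw [Finset.mul_sum, ← Finset.sum_add_distrib]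
    refine Finset.sum_congr rfl fun v _ => ?_
    rw [List.length_ofFn, hD]
    ring
  have h3 : |M * ∑ v, μ.real (cyl (List.ofFn v)) * D v| ≤ M * w.length := by
    rw [abs_mul, abs_of_pos hM]
    gcongr
    exact abs_sum_occ_sub_le hμ w l
  have h4 : |∑ v, ((⌈M * μ.real (cyl (List.ofFn v))⌉₊ : ℝ) -
      M * μ.real (cyl (List.ofFn v))) * D v| ≤ l * (S - M) := by
    refine (Finset.abs_sum_le_sum_abs _ _).trans ?_
    calc _ ≤ ∑ v : Fin l → Bool, ((⌈M * μ.real (cyl (List.ofFn v))⌉₊ : ℝ) -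
          M * μ.real (cyl (List.ofFn v))) * l := by
          refine Finset.sum_le_sum fun v _ => ?_
          rw [abs_mul, abs_of_nonneg (sub_nonneg.2 (Nat.le_ceil _))]
          refine mul_le_mul_of_nonneg_left ?_ (sub_nonneg.2 (Nat.le_ceil _))
          have a1 : (occ w (List.ofFn v) : ℝ) ≤ l := by
            have := occ_le_length w (List.ofFn v)
            rw [List.length_ofFn] at this
            exact_mod_cast this
          have a2 : (0 : ℝ) ≤ occ w (List.ofFn v) := by positivity
          rw [hD, abs_le]
          constructor <;> nlinarith
      _ = l * (S - M) := by
          rw [← Finset.sum_mul, Finset.sum_sub_distrib, hS', ← Finset.mul_sum, sum_cyl]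
          ring
  have hSM : M ≤ S := le_ceilTotal μ l M
  have hS1 : 1 ≤ S := by
    rw [hS]
    exact_mod_cast ceilTotal_pos μ l hM
  rw [h2] at h1
  have h5 : dev w c (weightedBlock μ ord l M) ≤
      w.length * S + M * w.length + l * (S - M) + w.length := by
    unfold dev weightedBlock
    rw [abs_le] at h1 h3 h4
    gcongr
    rw [abs_le]
    constructor <;> linarith [h1.1, h1.2, h3.1, h3.2, h4.1, h4.2]
  refine h5.trans ?_
  have hw : (0 : ℝ) ≤ w.length := by positivity
  nlinarith

/-! ### Genericity of the Champernowne sequences -/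

/-- `x` is generic for `μ`: every word occurs in `x` with the frequency prescribed by `μ`. -/
def IsGeneric (x : BinSeq) (μ : Measure BinSeq) : Prop :=
  ∀ w, Tendsto (fun n : ℕ => (visits x w n : ℝ) / n) atTop (𝓝 (μ.real (cyl w)))

lemma champWord_eq (μ : Measure BinSeq) (ord : ℕ → List (List Bool)) (M : ℕ → ℝ) (ℓ : ℕ → ℕ)
    (k : ℕ) : champWord μ ord M ℓ k =
      powConcat (fun j => weightedBlock μ ord (j + 1) (M (j + 1))) (fun j => ℓ (j + 1)) k := rfl

lemma powConcat_prefix (B : ℕ → List Bool) (ℓ : ℕ → ℕ) {j k : ℕ} (h : j ≤ k) :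
    powConcat B ℓ j <+: powConcat B ℓ k := by
  induction k, h using Nat.le_induction with
  | base => exact List.prefix_rfl
  | succ k _ ih => exact ih.trans (by rw [powConcat_succ]; exact List.prefix_append _ _)

lemma le_length_powConcat {B : ℕ → List Bool} {ℓ : ℕ → ℕ} (h : ∀ j, 0 < ℓ j * (B j).length)
    (k : ℕ) : k ≤ (powConcat B ℓ k).length := by
  induction k with
  | zero => simp
  | succ k ih =>
    rw [powConcat_succ, List.length_append, length_wpow]
    have := h k
    omega

lemma pre_champSeq {ord : ℕ → List (List Bool)} (hord : IsWordOrdering ord)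
    (μ : Measure BinSeq) [IsProbabilityMeasure μ] {M : ℕ → ℝ} {ℓ : ℕ → ℕ}
    (hM : ∀ i, 0 < M (i + 1)) (hℓ : ∀ i, 0 < ℓ (i + 1)) (n : ℕ) :
    n ≤ (champWord μ ord M ℓ n).length ∧
      pre (champSeq μ ord M ℓ) n = (champWord μ ord M ℓ n).take n := by
  have hlen : ∀ k, k ≤ (champWord μ ord M ℓ k).length := by
    intro k
    refine le_length_powConcat (fun j => ?_) k
    rw [length_weightedBlock hord]
    have := ceilTotal_pos μ (j + 1) (hM j)
    have := hℓ j
    positivity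
  refine ⟨hlen n, ?_⟩
  apply List.ext_getElem
  · simpa using hlen n
  · intro i h1 h2
    rw [pre_length] at h1
    have h3 : i < (champWord μ ord M ℓ (i + 1)).length := hlen (i + 1)
    simp only [pre, List.getElem_map, List.getElem_range, List.getElem_take, champSeq,
      List.getD_eq_getElem _ _ h3]
    exact (powConcat_prefix _ _ h1).getElem h3

/-- `hS` says that rounding up the exponents is negligible, so the blocks are good; `hR` says that
one copy of the next block is short compared with the power before it. -/
theorem isGeneric_champSeq {ord : ℕ → List (List Bool)} (hord : IsWordOrdering ord)
    {μ : Measure BinSeq} [IsProbabilityMeasure μ] (hμ : MeasurePreserving shift μ μ)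
    {M : ℕ → ℝ} {ℓ : ℕ → ℕ} (hM : ∀ i, 0 < M (i + 1)) (hℓ : ∀ i, 0 < ℓ (i + 1))
    (hS : ∀ ε > 0, ∀ᶠ i in atTop, (ceilTotal μ i (M i) : ℝ) ≤ (1 + ε) * M i)
    (hR : ∀ ε > 0, ∀ᶠ i in atTop, M (i + 1) ≤ ε * (ℓ i * M i)) :
    IsGeneric (champSeq μ ord M ℓ) μ := by
  intro w
  set c := μ.real (cyl w) with hc
  have hc0 : 0 ≤ c := measureReal_nonneg
  have hc1 : c ≤ 1 := measureReal_le_one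
  set B : ℕ → List Bool := fun j => weightedBlock μ ord (j + 1) (M (j + 1)) with hB
  have hlen : ∀ j, ((B j).length : ℝ) = (j + 1 : ℝ) * ceilTotal μ (j + 1) (M (j + 1)) := by
    intro j
    rw [hB, length_weightedBlock hord]; push_cast; ring
  have h1 : ∀ ε > 0, ∀ᶠ j in atTop, dev w c (B j) ≤ ε * (B j).length := by
    intro ε hε
    have e1 := (tendsto_add_atTop_nat 1).eventually (hS (ε / 2) (by positivity))
    -- The seams cost `3 |w| S` against a block length `(j + 1) S`, hence at most half of `ε` once
    -- `j` passes this threshold.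
    have e2 : ∀ᶠ j : ℕ in atTop, 6 * w.length / ε ≤ (j : ℝ) :=
      tendsto_natCast_atTop_atTop.eventually_ge_atTop _
    filter_upwards [e1, e2] with j h1 h2
    refine (dev_weightedBlock_le hord hμ w (j + 1) (hM j)).trans ?_
    rw [hlen]
    set S : ℝ := ((ceilTotal μ (j + 1) (M (j + 1)) : ℕ) : ℝ)
    have hMS : M (j + 1) ≤ S := le_ceilTotal _ _ _
    have hMp := hM j
    rw [div_le_iff₀ hε] at h2
    have a1 : 3 * w.length * S ≤ (ε / 2 * (j + 1)) * S := by
      apply mul_le_mul_of_nonneg_right _ (by linarith)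
      nlinarith
    have a2 : ((j + 1 : ℕ) : ℝ) * (S - M (j + 1)) ≤ (j + 1) * (ε / 2 * S) := by
      push_cast
      apply mul_le_mul_of_nonneg_left _ (by positivity)
      nlinarith
    linarith
  have h2 : ∀ ε > 0, ∀ᶠ j in atTop,
      ((B (j + 1)).length : ℝ) ≤ ε * (ℓ (j + 1) * (B j).length) := by
    intro ε hε
    have e1 := (tendsto_add_atTop_nat 1).eventually
      ((tendsto_add_atTop_nat 1).eventually (hS 1 one_pos))
    have e2 := (tendsto_add_atTop_nat 1).eventually (hR (ε / 4) (by positivity))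
    filter_upwards [e1, e2] with j h1 h2
    rw [hlen, hlen]
    set S : ℝ := ((ceilTotal μ (j + 1) (M (j + 1)) : ℕ) : ℝ)
    have hMS : M (j + 1) ≤ S := le_ceilTotal _ _ _
    have hMp := hM j
    have hj : (0 : ℝ) ≤ j := by positivity
    have hl0 : (0 : ℝ) ≤ ℓ (j + 1) := by positivity
    calc _ ≤ (2 * (j + 1 : ℝ)) * ((1 + 1) * M (j + 1 + 1)) := by
          push_cast
          gcongr
          linarith
      _ ≤ (2 * (j + 1 : ℝ)) * ((1 + 1) * (ε / 4 * (ℓ (j + 1) * M (j + 1)))) := by gcongr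
      _ = ε * (ℓ (j + 1) * ((j + 1) * M (j + 1))) := by ring
      _ ≤ _ := by gcongr
  rw [Metric.tendsto_atTop]
  intro ε hε
  obtain ⟨C, hC⟩ := exists_powConcat_take_le (m := (w.length : ℝ)) (dev_append_le w c)
    (by positivity) (dev_le w hc0 hc1) h1 h2 (show 0 < ε / 8 by positivity)
  obtain ⟨N, hN⟩ := exists_nat_gt (2 * C / ε)
  refine ⟨N + 1, fun n hn => ?_⟩
  obtain ⟨hn1, hn2⟩ := pre_champSeq hord μ hM hℓ n
  have h3 := hC n n hn1
  rw [← champWord_eq, ← hn2] at h3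
  unfold dev at h3
  rw [pre_length] at h3
  set x := champSeq μ ord M ℓ
  have a1 : (occ w (pre x n) : ℝ) ≤ visits x w n := by exact_mod_cast occ_pre_le_visits x w n
  have a2 : (visits x w n : ℝ) ≤ occ w (pre x n) + w.length := by
    exact_mod_cast visits_le_occ_pre x w n
  have hn0 : (0 : ℝ) < n := by exact_mod_cast (by omega : 0 < n)
  -- The summand `|w|` of `dev` pays for replacing `occ` by `visits`.
  have h4 : |(visits x w n : ℝ) - c * n| ≤ 2 * (ε / 8) * n + C := by
    refine le_trans ?_ h3
    have := abs_le.1 (le_refl |(occ w (pre x n) : ℝ) - c * n|)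
    rw [abs_le]
    constructor <;> linarith [this.1, this.2]
  have hCn : C < ε / 2 * n := by
    rw [div_lt_iff₀ hε] at hN
    have : (N : ℝ) ≤ n := by exact_mod_cast (by omega : N ≤ n)
    nlinarith
  rw [Real.dist_eq, show (visits x w n : ℝ) / n - c = ((visits x w n : ℝ) - c * n) / n by
    field_simp, abs_div, abs_of_pos hn0, div_lt_iff₀ hn0]
  nlinarith

/-! ### Entropies of a generic sequence -/

lemma mul_logb_two (t : ℝ) : t * Real.logb 2 t = -(Real.negMulLog t / Real.log 2) := by
  rw [Real.logb, Real.negMulLog]; ring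

lemma wordEntropy_eq (μ : Measure BinSeq) (n : ℕ) :
    wordEntropy μ n =
      (∑ v : Fin n → Bool, Real.negMulLog (μ.real (cyl (List.ofFn v)))) / Real.log 2 := by
  rw [wordEntropy, Finset.sum_div, ← Finset.sum_neg_distrib]
  refine Finset.sum_congr rfl fun v _ => ?_
  rw [mul_logb_two, neg_neg]

lemma wordEntropy_nonneg (μ : Measure BinSeq) [IsProbabilityMeasure μ] (n : ℕ) :
    0 ≤ wordEntropy μ n := by
  rw [wordEntropy_eq]
  refine div_nonneg (Finset.sum_nonneg fun v _ => ?_) (Real.log_nonneg (by norm_num))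
  exact Real.negMulLog_nonneg measureReal_nonneg measureReal_le_one

lemma IsGeneric.tendsto_slideProb {x : BinSeq} {μ : Measure BinSeq} (h : IsGeneric x μ)
    (w : List Bool) :
    Tendsto (fun n => slideProb (pre x n) w) atTop (𝓝 (μ.real (cyl w))) := by
  have h1 : Tendsto (fun n : ℕ => n + 1 - w.length) atTop atTop := by
    refine tendsto_atTop.2 fun b => ?_
    filter_upwards [eventually_ge_atTop (b + w.length)] with n hn
    omega
  refine ((h w).comp h1).congr' ?_
  filter_upwards [eventually_ge_atTop w.length] with n hn
  rw [slideProb_pre x w hn]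
  rfl

lemma IsGeneric.tendsto_blockEntropy {x : BinSeq} {μ : Measure BinSeq} (h : IsGeneric x μ)
    (l : ℕ) : Tendsto (fun n => blockEntropy l (pre x n)) atTop (𝓝 (wordEntropy μ l / l)) := by
  have hc : Continuous fun t : ℝ => t * Real.logb 2 t := by
    simp_rw [mul_logb_two]
    exact (Real.continuous_negMulLog.div_const _).neg
  have h1 : wordEntropy μ l / l = -(1 / (l : ℝ)) * ∑ w : Fin l → Bool,
      μ.real (cyl (List.ofFn w)) * Real.logb 2 (μ.real (cyl (List.ofFn w))) := by
    rw [wordEntropy]; ring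
  rw [h1]
  unfold blockEntropy
  refine Tendsto.const_mul _ (tendsto_finsetSum _ fun w _ => ?_)
  exact (hc.tendsto _).comp (h.tendsto_slideProb (List.ofFn w))

lemma IsGeneric.dimFS_eq {x : BinSeq} {μ : Measure BinSeq} (h : IsGeneric x μ) :
    dimFS x = ⨅ l : ℕ+, wordEntropy μ l / l := by
  unfold dimFS
  congr 1
  ext l
  exact (h.tendsto_blockEntropy l).liminf_eq

lemma IsGeneric.strongDimFS_eq {x : BinSeq} {μ : Measure BinSeq} (h : IsGeneric x μ) :
    strongDimFS x = ⨅ l : ℕ+, wordEntropy μ l / l := by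
  unfold strongDimFS
  congr 1
  ext l
  exact (h.tendsto_blockEntropy l).limsup_eq

/-! ### Subadditivity of the entropy of an invariant measure -/

lemma cyl_append (u v : List Bool) : cyl (u ++ v) = cyl u ∩ shift^[u.length] ⁻¹' cyl v := by
  ext x
  simp only [mem_cyl, List.length_append, pre_append, Set.mem_inter_iff, Set.mem_preimage]
  exact List.append_eq_append_iff_of_size_eq_left (by simp)

lemma sum_cyl_append_right (μ : Measure BinSeq) [IsProbabilityMeasure μ] (u : List Bool) (n : ℕ) :
    ∑ v : Fin n → Bool, μ.real (cyl (u ++ List.ofFn v)) = μ.real (cyl u) := by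
  rw [← measureReal_biUnion_finset]
  · congr 1
    ext x
    simp only [cyl_append, cyl_ofFn]
    simp
  · intro v _ v' _ hv
    refine Set.disjoint_left.2 fun x hx hx' => hv ?_
    simp only [cyl_append, cyl_ofFn] at hx hx'
    exact hx.2.symm.trans hx'.2
  · exact fun v _ => measurableSet_cyl _

lemma sum_cyl_append_left {μ : Measure BinSeq} [IsProbabilityMeasure μ]
    (hμ : MeasurePreserving shift μ μ) (m : ℕ) (w : List Bool) :
    ∑ v : Fin m → Bool, μ.real (cyl (List.ofFn v ++ w)) = μ.real (cyl w) := by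
  rw [← measureReal_preimage_shift_iterate hμ m w, ← measureReal_biUnion_finset]
  · congr 1
    ext x
    simp only [cyl_append, cyl_ofFn]
    simp
  · intro v _ v' _ hv
    refine Set.disjoint_left.2 fun x hx hx' => hv ?_
    simp only [cyl_append, cyl_ofFn] at hx hx'
    exact hx.1.symm.trans hx'.1
  · exact fun v _ => measurableSet_cyl _

lemma sum_fin_add {A : Type*} [AddCommMonoid A] (m n : ℕ) (F : List Bool → A) :
    ∑ w : Fin (m + n) → Bool, F (List.ofFn w) =
      ∑ u : Fin m → Bool, ∑ v : Fin n → Bool, F (List.ofFn u ++ List.ofFn v) := by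
  rw [← Fintype.sum_prod_type', ← (Fin.appendEquiv m n).sum_comp]
  refine Finset.sum_congr rfl fun p _ => ?_
  simp [Fin.appendEquiv, List.ofFn_fin_append]

/-- Pointwise Gibbs inequality: `log t ≤ t - 1` at `t = q / a`, multiplied by `a`. -/
lemma negMulLog_le_of_pos {a q : ℝ} (ha : 0 ≤ a) (hq : 0 ≤ q) (h : q = 0 → a = 0) :
    Real.negMulLog a ≤ -(a * Real.log q) + (q - a) := by
  rcases ha.eq_or_lt with rfl | ha
  · simpa using hq
  have hq' : 0 < q := lt_of_le_of_ne hq fun h' => ha.ne' (h h'.symm)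
  have := Real.log_le_sub_one_of_pos (div_pos hq' ha)
  rw [Real.log_div hq'.ne' ha.ne'] at this
  have h2 := mul_le_mul_of_nonneg_left this ha.le
  have h3 : a * (q / a - 1) = q - a := by field_simp
  rw [h3] at h2
  rw [Real.negMulLog]
  linarith

/-- Nonnegativity of mutual information: the Gibbs inequality compares the joint law `a u v` with
the product `r u * s v` of its marginals. Invariance is what makes the second marginal the law of
the first `n` digits. -/
lemma subadditive_wordEntropy {μ : Measure BinSeq} [IsProbabilityMeasure μ]
    (hμ : MeasurePreserving shift μ μ) : Subadditive (wordEntropy μ) := by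
  intro m n
  simp only [wordEntropy_eq]
  rw [← add_div]
  refine div_le_div_of_nonneg_right ?_ (Real.log_nonneg (by norm_num))
  rw [sum_fin_add m n fun w => Real.negMulLog (μ.real (cyl w))]
  set r : (Fin m → Bool) → ℝ := fun u => μ.real (cyl (List.ofFn u)) with hr
  set s : (Fin n → Bool) → ℝ := fun v => μ.real (cyl (List.ofFn v)) with hs
  set a : (Fin m → Bool) → (Fin n → Bool) → ℝ :=
    fun u v => μ.real (cyl (List.ofFn u ++ List.ofFn v)) with ha
  have har : ∀ u, ∑ v, a u v = r u := fun u => sum_cyl_append_right μ _ n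
  have has : ∀ v, ∑ u, a u v = s v := fun v => sum_cyl_append_left hμ m _
  have ha0 : ∀ u v, 0 ≤ a u v := fun _ _ => measureReal_nonneg
  have hle_r : ∀ u v, a u v ≤ r u := fun u v => by
    rw [← har u]
    exact Finset.single_le_sum (f := fun v => a u v) (fun v _ => ha0 u v) (Finset.mem_univ v)
  have hle_s : ∀ u v, a u v ≤ s v := fun u v => by
    rw [← has v]
    exact Finset.single_le_sum (f := fun u => a u v) (fun u _ => ha0 u v) (Finset.mem_univ u)
  have key : ∀ u v, Real.negMulLog (a u v) ≤
      -(a u v * Real.log (r u)) + -(a u v * Real.log (s v)) + (r u * s v - a u v) := by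
    intro u v
    have hr0 : 0 ≤ r u := measureReal_nonneg
    have hs0 : 0 ≤ s v := measureReal_nonneg
    rcases (ha0 u v).eq_or_lt with h0 | h0
    · rw [← h0]; simpa using mul_nonneg hr0 hs0
    have hrp := h0.trans_le (hle_r u v)
    have hsp := h0.trans_le (hle_s u v)
    have := negMulLog_le_of_pos (ha0 u v) (mul_nonneg hr0 hs0)
      (fun h => absurd h (mul_pos hrp hsp).ne')
    rw [Real.log_mul hrp.ne' hsp.ne'] at this
    linarith
  -- Both laws have total mass `1`, so the linear corrections cancel.
  have hrs : ∑ u, ∑ v, (r u * s v - a u v) = 0 := by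
    simp_rw [Finset.sum_sub_distrib, har, ← Finset.mul_sum]
    simp [hr, hs, sum_cyl]
  calc ∑ u, ∑ v, Real.negMulLog (a u v)
      ≤ ∑ u, ∑ v, (-(a u v * Real.log (r u)) + -(a u v * Real.log (s v)) + (r u * s v - a u v)) :=
        Finset.sum_le_sum fun u _ => Finset.sum_le_sum fun v _ => key u v
    _ = ∑ u, ∑ v, -(a u v * Real.log (r u)) + ∑ u, ∑ v, -(a u v * Real.log (s v)) := by
        simp only [Finset.sum_add_distrib]
        rw [hrs, add_zero]
    _ = _ := by
        rw [Finset.sum_comm (f := fun u v => -(a u v * Real.log (s v)))]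
        simp only [Finset.sum_neg_distrib, ← Finset.sum_mul, har, has, hr, hs, Real.negMulLog,
          neg_mul]

/-- Fekete's lemma: the limit exists and equals the infimum appearing in both dimensions. -/
lemma tendsto_wordEntropy_div {μ : Measure BinSeq} [IsProbabilityMeasure μ]
    (hμ : MeasurePreserving shift μ μ) :
    Tendsto (fun n : ℕ => wordEntropy μ n / n) atTop (𝓝 (⨅ l : ℕ+, wordEntropy μ l / l)) := by
  have hb : BddBelow (Set.range fun n : ℕ => wordEntropy μ n / n) :=
    ⟨0, by rintro _ ⟨n, rfl⟩; exact div_nonneg (wordEntropy_nonneg μ n) n.cast_nonneg⟩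
  have h := (subadditive_wordEntropy hμ).tendsto_lim hb
  convert h using 2
  rw [Subadditive.lim, iInf]
  congr 1
  ext t
  constructor
  · rintro ⟨l, rfl⟩
    exact ⟨l, l.pos, rfl⟩
  · rintro ⟨n, hn, rfl⟩
    exact ⟨⟨n, hn⟩, rfl⟩

theorem IsGeneric.dim_eq_upperEntropy {x : BinSeq} {μ : Measure BinSeq} [IsProbabilityMeasure μ]
    (hμ : MeasurePreserving shift μ μ) (h : IsGeneric x μ) :
    dimFS x = upperEntropy μ ∧ strongDimFS x = upperEntropy μ := by
  rw [h.dimFS_eq, h.strongDimFS_eq, upperEntropy, (tendsto_wordEntropy_div hμ).limsup_eq]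
  exact ⟨rfl, rfl⟩

/-! ### Weyl averages of a generic sequence -/

lemma sum_proj_shift (x : BinSeq) {m : ℕ} (φ : (Fin m → Bool) → ℂ) (n : ℕ) :
    ∑ j ∈ Finset.range n, φ (fun i => (shift^[j] x) i) =
      ∑ v, (visits x (List.ofFn v) n : ℂ) * φ v := by
  classical
  simp_rw [visits_eq_sum, cyl_ofFn]
  push_cast
  simp_rw [Finset.sum_mul]
  rw [Finset.sum_comm]
  refine Finset.sum_congr rfl fun j _ => ?_
  simp

lemma IsGeneric.tendsto_average_proj {x : BinSeq} {μ : Measure BinSeq} [IsProbabilityMeasure μ]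
    (h : IsGeneric x μ) {m : ℕ} (φ : (Fin m → Bool) → ℂ) :
    Tendsto (fun n : ℕ => (1 / (n : ℂ)) * ∑ j ∈ Finset.range n, φ (fun i => (shift^[j] x) i))
      atTop (𝓝 (∫ y, φ (fun i => y i) ∂μ)) := by
  rw [integral_proj]
  simp_rw [sum_proj_shift, Finset.mul_sum]
  refine tendsto_finsetSum _ fun v _ => ?_
  have := (Complex.continuous_ofReal.tendsto _).comp (h (List.ofFn v))
  have := this.mul_const (φ v)
  rw [Complex.real_smul]
  refine this.congr fun n => ?_
  simp only [Function.comp_apply, Complex.ofReal_div, Complex.ofReal_natCast]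
  ring

lemma IsGeneric.tendsto_average {x : BinSeq} {μ : Measure BinSeq} [IsProbabilityMeasure μ]
    (h : IsGeneric x μ) {f : BinSeq → ℂ} (hf : Integrable f μ)
    (happ : ∀ ε > 0, ∃ (m : ℕ) (φ : (Fin m → Bool) → ℂ), ∀ y, ‖f y - φ (fun i => y i)‖ ≤ ε) :
    Tendsto (fun n : ℕ => (1 / (n : ℂ)) * ∑ j ∈ Finset.range n, f (shift^[j] x))
      atTop (𝓝 (∫ y, f y ∂μ)) := by
  rw [Metric.tendsto_atTop]
  intro ε hε
  obtain ⟨m, φ, hφ⟩ := happ (ε / 4) (by positivity)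
  obtain ⟨N, hN⟩ := Metric.tendsto_atTop.1 (h.tendsto_average_proj φ) (ε / 4) (by positivity)
  refine ⟨N + 1, fun n hn => ?_⟩
  have h1 := hN n (by omega)
  have hn0 : (0 : ℝ) < n := by exact_mod_cast (by omega : 0 < n)
  have hφi : Integrable (fun y : BinSeq => φ (fun i => y i)) μ := by
    obtain ⟨C, hC⟩ := (Set.finite_range fun v => ‖φ v‖).bddAbove
    refine Integrable.of_bound (C := C) ?_ (ae_of_all _ fun y => hC ⟨_, rfl⟩)
    exact ((measurable_of_finite φ).comp (measurable_proj m)).aestronglyMeasurable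
  have h2 : ‖∫ y, φ (fun i => y i) ∂μ - ∫ y, f y ∂μ‖ ≤ ε / 4 := by
    rw [← integral_sub hφi hf]
    have := norm_integral_le_of_norm_le_const (μ := μ) (C := ε / 4)
      (f := fun y : BinSeq => φ (fun i => y i) - f y)
      (ae_of_all _ fun y => by rw [norm_sub_rev]; exact hφ y)
    simpa using this
  have h3 : ‖(1 / (n : ℂ)) * ∑ j ∈ Finset.range n, f (shift^[j] x) -
      (1 / (n : ℂ)) * ∑ j ∈ Finset.range n, φ (fun i => (shift^[j] x) i)‖ ≤ ε / 4 := by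
    rw [← mul_sub, ← Finset.sum_sub_distrib, norm_mul]
    have : ‖∑ j ∈ Finset.range n, (f (shift^[j] x) - φ (fun i => (shift^[j] x) i))‖ ≤
        n * (ε / 4) := by
      refine (norm_sum_le _ _).trans ?_
      refine (Finset.sum_le_sum fun j _ => hφ (shift^[j] x)).trans ?_
      simp
    rw [norm_div, norm_one, Complex.norm_natCast]
    calc _ ≤ 1 / (n : ℝ) * (n * (ε / 4)) := by gcongr
      _ = ε / 4 := by field_simp
  rw [dist_eq_norm] at h1 ⊢
  calc _ = ‖((1 / (n : ℂ)) * ∑ j ∈ Finset.range n, f (shift^[j] x) -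
          (1 / (n : ℂ)) * ∑ j ∈ Finset.range n, φ (fun i => (shift^[j] x) i)) +
        ((1 / (n : ℂ)) * ∑ j ∈ Finset.range n, φ (fun i => (shift^[j] x) i) -
          ∫ y, φ (fun i => y i) ∂μ) + (∫ y, φ (fun i => y i) ∂μ - ∫ y, f y ∂μ)‖ := by
        congr 1; ring
    _ ≤ ε / 4 + ε / 4 + ε / 4 := by
        refine (norm_add_le _ _).trans (add_le_add ?_ h2)
        exact (norm_add_le _ _).trans (add_le_add h3 h1.le)
    _ < ε := by linarith

lemma digit_mem (b : Bool) : 0 ≤ digit b ∧ digit b ≤ 1 := by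
  cases b <;> simp [digit]

lemma summable_digit (y : BinSeq) : Summable fun i : ℕ => digit (y i) / 2 ^ (i + 1) := by
  refine Summable.of_nonneg_of_le (fun i => div_nonneg (digit_mem _).1 (by positivity))
    (fun i => ?_) (summable_geometric_two' 1)
  rw [pow_succ', div_div]
  exact div_le_div_of_nonneg_right (digit_mem _).2 (by positivity)

lemma abs_tsum_digit_sub_le (y : BinSeq) (m : ℕ) :
    |∑' i : ℕ, digit (y i) / 2 ^ (i + 1) - ∑ i ∈ Finset.range m, digit (y i) / 2 ^ (i + 1)| ≤
      1 / 2 ^ m := by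
  have h := summable_digit y
  rw [← h.sum_add_tsum_nat_add m, add_sub_cancel_left]
  have hs := (summable_nat_add_iff m).2 h
  have h0 : ∀ i, 0 ≤ digit (y (i + m)) / 2 ^ (i + m + 1) := fun i =>
    div_nonneg (digit_mem _).1 (by positivity)
  rw [abs_of_nonneg (tsum_nonneg h0)]
  have hg : HasSum (fun i : ℕ => (1 / 2 ^ m : ℝ) / 2 / 2 ^ i) (1 / 2 ^ m) := hasSum_geometric_two' _
  refine (hs.tsum_le_tsum (fun i => ?_) hg.summable).trans hg.tsum_eq.le
  rw [div_div, div_div, show (2 : ℝ) ^ m * (2 * 2 ^ i) = 2 ^ (i + m + 1) by ring]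
  exact div_le_div_of_nonneg_right (digit_mem _).2 (by positivity)

/-- Periodicity of the exponential removes the fractional part, whose jumps would obstruct uniform
approximation. -/
lemma char_eq (k : ℤ) (y : BinSeq) :
    char k y = Complex.exp (Complex.I *
      ((2 * Real.pi * k * ∑' i : ℕ, digit (y i) / 2 ^ (i + 1) : ℝ) : ℂ)) := by
  unfold char val
  set t := ∑' i : ℕ, digit (y i) / 2 ^ (i + 1)
  have h : (t : ℂ) = (Int.fract t : ℝ) + (⌊t⌋ : ℂ) := by
    have := (Int.fract_add_floor t).symm
    exact_mod_cast this
  push_cast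
  rw [h, show Complex.I * (2 * Real.pi * k * ((Int.fract t : ℝ) + (⌊t⌋ : ℂ))) =
    2 * Real.pi * Complex.I * k * (Int.fract t : ℝ) +
      ((k * ⌊t⌋ : ℤ) : ℂ) * (2 * Real.pi * Complex.I) by
    push_cast; ring, Complex.exp_periodic.int_mul]

lemma norm_exp_sub_exp_le (s t : ℝ) :
    ‖Complex.exp (Complex.I * s) - Complex.exp (Complex.I * t)‖ ≤ |s - t| := by
  have h : Complex.exp (Complex.I * s) - Complex.exp (Complex.I * t) =
      Complex.exp (Complex.I * t) * (Complex.exp (Complex.I * ((s - t : ℝ) : ℂ)) - 1) := by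
    rw [mul_sub, ← Complex.exp_add, mul_one]
    push_cast
    ring_nf
  rw [h, norm_mul, mul_comm Complex.I, Complex.norm_exp_ofReal_mul_I, one_mul]
  exact Real.norm_exp_I_mul_ofReal_sub_one_le

lemma exists_norm_char_sub_le (k : ℤ) {ε : ℝ} (hε : 0 < ε) :
    ∃ (m : ℕ) (φ : (Fin m → Bool) → ℂ), ∀ y, ‖char k y - φ (fun i => y i)‖ ≤ ε := by
  obtain ⟨m, hm⟩ := exists_pow_lt_of_lt_one
    -- The `+ 1` keeps the denominator positive when `k = 0`.
    (show 0 < ε / (2 * Real.pi * |(k : ℝ)| + 1) by positivity) (by norm_num : (1 / 2 : ℝ) < 1)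
  refine ⟨m, fun v => Complex.exp (Complex.I *
    ((2 * Real.pi * k * ∑ i : Fin m, digit (v i) / 2 ^ ((i : ℕ) + 1) : ℝ) : ℂ)), fun y => ?_⟩
  rw [char_eq]
  refine (norm_exp_sub_exp_le _ _).trans ?_
  rw [← mul_sub, abs_mul, Fin.sum_univ_eq_sum_range (fun i => digit (y i) / 2 ^ (i + 1)) m]
  have h1 := abs_tsum_digit_sub_le y m
  rw [lt_div_iff₀ (by positivity), one_div, inv_pow, ← one_div] at hm
  have h2 : |2 * Real.pi * (k : ℝ)| = 2 * Real.pi * |(k : ℝ)| := by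
    rw [abs_mul, abs_of_pos (by positivity)]
  rw [h2]
  calc _ ≤ 2 * Real.pi * |(k : ℝ)| * (1 / 2 ^ m) := by gcongr
    _ ≤ 1 / 2 ^ m * (2 * Real.pi * |(k : ℝ)| + 1) := by
        have : (0 : ℝ) ≤ 1 / 2 ^ m := by positivity
        nlinarith
    _ ≤ ε := hm.le

lemma integrable_char (μ : Measure BinSeq) [IsProbabilityMeasure μ] (k : ℤ) :
    Integrable (char k) μ := by
  have hc : Measurable (char k) := by
    choose m φ h using fun n : ℕ =>
      exists_norm_char_sub_le k (Nat.one_div_pos_of_nat (α := ℝ) (n := n))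
    refine measurable_of_tendsto_metrizable
      (f := fun (n : ℕ) (y : BinSeq) => φ n (fun i => y i)) (fun n => ?_) ?_
    · exact (measurable_of_finite (φ n)).comp (measurable_proj (m n))
    · rw [tendsto_pi_nhds]
      intro y
      rw [tendsto_iff_norm_sub_tendsto_zero]
      refine squeeze_zero (fun _ => norm_nonneg _) (fun n => ?_)
        tendsto_one_div_add_atTop_nhds_zero_nat
      rw [norm_sub_rev]
      exact h n y
  refine Integrable.of_bound hc.aestronglyMeasurable 1 (ae_of_all _ fun y => ?_)
  rw [char_eq, mul_comm, Complex.norm_exp_ofReal_mul_I]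

theorem IsGeneric.tendsto_weylAvg {x : BinSeq} {μ : Measure BinSeq} [IsProbabilityMeasure μ]
    (h : IsGeneric x μ) (k : ℤ) :
    Tendsto (weylAvg x k) atTop (𝓝 (∫ y, char k y ∂μ)) :=
  h.tendsto_average (integrable_char μ k) fun _ hε => exists_norm_char_sub_le k hε

/-! ### The Champernowne sequence of an invariant measure -/

/-- Total mass `1` forces some cylinder of each length to be charged, and a finite nonempty set
attains its infimum. -/
lemma minPos_pos (μ : Measure BinSeq) [IsProbabilityMeasure μ] (l : ℕ) : 0 < minPos μ l := by
  set s : Set ℝ := {r : ℝ | 0 < r ∧ ∃ w : List Bool, w.length = l ∧ μ.real (cyl w) = r} with hs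
  have hfin : s.Finite := by
    refine (Set.finite_range fun v : Fin l → Bool => μ.real (cyl (List.ofFn v))).subset ?_
    rintro r ⟨_, w, rfl, rfl⟩
    obtain ⟨v, hv⟩ := exists_ofFn_eq w
    exact ⟨v, by simp only [hv]⟩
  have hne : s.Nonempty := by
    by_contra h
    have h0 : ∀ v : Fin l → Bool, μ.real (cyl (List.ofFn v)) = 0 := by
      intro v
      by_contra hv
      exact h ⟨_, lt_of_le_of_ne measureReal_nonneg (Ne.symm hv), List.ofFn v, by simp, rfl⟩
    have := sum_cyl μ l
    simp [h0] at this
  exact (hne.csInf_mem hfin).1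

lemma champM_pos (b : ℝ) (μ : Measure BinSeq) [IsProbabilityMeasure μ] (i : ℕ) :
    0 < champM b μ i :=
  Nat.ceil_pos.2 (lt_max_of_lt_right (inv_pos.2 (minPos_pos μ i)))

lemma champRep_pos {b : ℝ} (hb : 1 < b) (μ : Measure BinSeq) [IsProbabilityMeasure μ] (i : ℕ) :
    0 < champRep b μ i := by
  rcases i with _ | _ | j
  · simp [champRep]
  · simp [champRep]
  · rw [champRep]
    refine Nat.ceil_pos.2 (mul_pos (Real.logb_pos hb ?_) (lt_max_of_lt_left ?_))
    · exact_mod_cast (by omega : 1 < j + 2)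
    · have := champM_pos b μ (j + 2)
      have := champM_pos b μ (j + 3)
      positivity

/-- Rounding the `2^i` exponents adds at most `2^i`, which is negligible against weights of size at
least `4^i`. -/
lemma eventually_two_pow_le {A : ℕ → ℝ} (hA : ∀ᶠ i in atTop, (4 : ℝ) ^ i ≤ A i) {ε : ℝ}
    (hε : 0 < ε) : ∀ᶠ i in atTop, (2 : ℝ) ^ i ≤ ε * A i := by
  have h := (tendsto_pow_atTop_atTop_of_one_lt (one_lt_two (α := ℝ))).eventually_ge_atTop (1 / ε)
  filter_upwards [hA, h] with i h1 h2
  rw [div_le_iff₀ hε] at h2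
  have h4 : (4 : ℝ) ^ i = 2 ^ i * 2 ^ i := by rw [← mul_pow]; norm_num
  have h0 : (0 : ℝ) < 2 ^ i := by positivity
  nlinarith

/-- The term `i^{2i} log i` makes `M_i ≥ 4^i` eventually; the first entry of the maximum in `ℓ_i`
gives `ℓ_i M_i ≥ M_{i+1} log i`, with `log i → ∞`. -/
theorem isGeneric_champernowne {b : ℝ} (hb : 1 < b) {ord : ℕ → List (List Bool)}
    (hord : IsWordOrdering ord) {μ : Measure BinSeq} [IsProbabilityMeasure μ]
    (hμ : MeasurePreserving shift μ μ) : IsGeneric (champernowne b μ ord) μ := by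
  have hlog : Tendsto (fun i : ℕ => Real.logb b i) atTop atTop :=
    (Real.tendsto_logb_atTop hb).comp tendsto_natCast_atTop_atTop
  refine isGeneric_champSeq hord hμ (fun i => by exact_mod_cast champM_pos b μ (i + 1))
    (fun i => champRep_pos hb μ (i + 1)) ?_ ?_
  · intro ε hε
    have hA : ∀ᶠ i : ℕ in atTop, (4 : ℝ) ^ i ≤ (champM b μ i : ℝ) := by
      filter_upwards [hlog.eventually_ge_atTop 1, eventually_ge_atTop 2] with i h1 h2
      have h2' : (2 : ℝ) ≤ i := by exact_mod_cast h2
      calc (4 : ℝ) ^ i = (2 : ℝ) ^ (2 * i) := by rw [pow_mul]; norm_num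
        _ ≤ (i : ℝ) ^ (2 * i) := by gcongr
        _ ≤ (i : ℝ) ^ (2 * i) * Real.logb b i := le_mul_of_one_le_right (by positivity) h1
        _ ≤ _ := (le_max_left _ _).trans (Nat.le_ceil _)
    filter_upwards [eventually_two_pow_le hA hε] with i hi
    have := ceilTotal_le μ i (M := (champM b μ i : ℝ)) (by positivity)
    linarith
  · intro ε hε
    filter_upwards [hlog.eventually_ge_atTop (1 / ε), eventually_ge_atTop 2] with i h1 h2
    obtain ⟨j, rfl⟩ : ∃ j, i = j + 2 := ⟨i - 2, by omega⟩
    have hMpos : (0 : ℝ) < champM b μ (j + 2) := by exact_mod_cast champM_pos b μ (j + 2)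
    have hL : 0 < Real.logb b ((j + 2 : ℕ) : ℝ) := lt_of_lt_of_le (by positivity) h1
    have h3 : Real.logb b ((j + 2 : ℕ) : ℝ) *
        (((champM b μ (j + 3) : ℝ) + ((j + 3 : ℕ) : ℝ) ^ (j + 3)) / (champM b μ (j + 2) : ℝ)) ≤
        champRep b μ (j + 2) := by
      rw [champRep]
      refine le_trans ?_ (Nat.le_ceil _)
      exact mul_le_mul_of_nonneg_left (le_max_left _ _) hL.le
    have h4 : (champM b μ (j + 3) : ℝ) ≤
        (((champM b μ (j + 3) : ℝ) + ((j + 3 : ℕ) : ℝ) ^ (j + 3)) / (champM b μ (j + 2) : ℝ)) *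
          champM b μ (j + 2) := by
      rw [div_mul_cancel₀ _ hMpos.ne']
      have : (0 : ℝ) ≤ ((j + 3 : ℕ) : ℝ) ^ (j + 3) := by positivity
      linarith
    rw [div_le_iff₀ hε] at h1
    set Q := ((champM b μ (j + 3) : ℝ) + ((j + 3 : ℕ) : ℝ) ^ (j + 3)) / (champM b μ (j + 2) : ℝ)
    have hQ : 0 ≤ Q := by positivity
    calc (champM b μ (j + 2 + 1) : ℝ) ≤ Q * champM b μ (j + 2) := h4
      _ ≤ (Real.logb b ((j + 2 : ℕ) : ℝ) * ε) * (Q * champM b μ (j + 2)) :=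
          le_mul_of_one_le_left (by positivity) h1
      _ = ε * ((Real.logb b ((j + 2 : ℕ) : ℝ) * Q) * champM b μ (j + 2)) := by ring
      _ ≤ _ := by gcongr

/-! ### Bernoulli measures -/

/-- The probability of the digit `d` under the bias `p`. -/
def digitProb (p : ℝ) (d : Bool) : ℝ := if d then p else 1 - p

lemma bernoulliSeq_real_cyl (p : unitInterval) (w : List Bool) :
    (bernoulliSeq p).real (cyl w) = (w.map (digitProb p)).prod := by
  have h : cyl w = Set.pi (Finset.range w.length : Set ℕ) fun i => {w.getD i false} := by
    ext x
    rw [mem_cyl, Set.mem_pi]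
    constructor
    · intro h i hi
      have hi' : i < w.length := by simpa using hi
      have h1 : (pre x w.length)[i]'(by simpa using hi') = w[i] := by simp only [h]
      rw [List.getD_eq_getElem _ _ hi', ← h1]
      simp [pre]
    · intro h
      apply List.ext_getElem
      · simp
      · intro i h1 h2
        have := h i (by simpa using h2)
        rw [List.getD_eq_getElem _ _ h2] at this
        simpa [pre] using this
  rw [measureReal_def, h, bernoulliSeq,
    Measure.infinitePi_pi _ (fun _ _ => measurableSet_singleton _),
    ENNReal.toReal_prod]
  have hd : ∀ d : Bool,
      (ProbabilityTheory.bernoulliMeasure true false p {d}).toReal = digitProb p d := by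
    intro d
    rw [← measureReal_def,
      ProbabilityTheory.bernoulliMeasure_real_apply p (measurableSet_singleton d)]
    cases d <;> simp [digitProb]
  simp_rw [hd]
  clear h
  induction w with
  | nil => simp
  | cons d w ih =>
    rw [List.length_cons, Finset.prod_range_succ', List.map_cons, List.prod_cons, ← ih, mul_comm]
    simp

lemma measurePreserving_shift_bernoulliSeq (p : unitInterval) :
    MeasurePreserving shift (bernoulliSeq p) (bernoulliSeq p) := by
  have hm : Measurable shift := measurable_pi_lambda _ fun i => measurable_pi_apply _
  refine ⟨hm, ?_⟩
  refine Measure.eq_infinitePi _ fun s t ht => ?_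
  rw [Measure.map_apply hm (MeasurableSet.pi s.countable_toSet fun i _ => ht i)]
  have h : shift ⁻¹' Set.pi (s : Set ℕ) t =
      Set.pi (s.map ⟨Nat.succ, Nat.succ_injective⟩ : Set ℕ) fun i => t (i - 1) := by
    ext x
    simp [Set.mem_pi, shift]
  rw [h, bernoulliSeq, Measure.infinitePi_pi _ (fun i _ => ht _), Finset.prod_map]
  simp

instance (p : unitInterval) : IsProbabilityMeasure (bernoulliSeq p) := by
  unfold bernoulliSeq; infer_instance

lemma wordEntropy_bernoulliSeq_add (p : unitInterval) (m n : ℕ) :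
    wordEntropy (bernoulliSeq p) (m + n) =
      wordEntropy (bernoulliSeq p) m + wordEntropy (bernoulliSeq p) n := by
  simp only [wordEntropy_eq]
  rw [← add_div, sum_fin_add m n fun w => Real.negMulLog ((bernoulliSeq p).real (cyl w))]
  have h : ∀ u v : List Bool, (bernoulliSeq p).real (cyl (u ++ v)) =
      (bernoulliSeq p).real (cyl u) * (bernoulliSeq p).real (cyl v) := by
    intro u v
    simp [bernoulliSeq_real_cyl]
  simp_rw [h, Real.negMulLog_mul, Finset.sum_add_distrib, ← Finset.mul_sum, ← Finset.sum_mul]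
  simp only [sum_cyl, one_mul]

lemma wordEntropy_bernoulliSeq_one (p : unitInterval) :
    wordEntropy (bernoulliSeq p) 1 = entropy₂ p := by
  rw [wordEntropy, ← (Equiv.funUnique (Fin 1) Bool).symm.sum_comp]
  simp [bernoulliSeq_real_cyl, digitProb, entropy₂]
  ring

lemma wordEntropy_bernoulliSeq (p : unitInterval) (n : ℕ) :
    wordEntropy (bernoulliSeq p) n = n * entropy₂ p := by
  induction n with
  | zero =>
    have := wordEntropy_bernoulliSeq_add p 0 0
    simp at this
    simp [this]
  | succ n ih =>
    rw [wordEntropy_bernoulliSeq_add, ih, wordEntropy_bernoulliSeq_one]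
    push_cast; ring

lemma upperEntropy_bernoulliSeq (p : unitInterval) :
    upperEntropy (bernoulliSeq p) = entropy₂ p := by
  refine Tendsto.limsup_eq (tendsto_const_nhds.congr' ?_)
  filter_upwards [eventually_gt_atTop 0] with n hn
  have : (n : ℝ) ≠ 0 := by positivity
  rw [wordEntropy_bernoulliSeq]
  field_simp

lemma minBias_cases (p : unitInterval) :
    ∃ d : Bool, digitProb p d = minBias p ∧ digitProb p (!d) = 1 - minBias p ∧
      (minBias p = 1 ∨ 0 < minBias p ∧ minBias p ≤ 1 / 2) := by
  obtain ⟨p, h0, h1⟩ := p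
  have key : ∀ r : ℝ, 0 < r → (r = p ∨ r = 1 - p) → (0 < p → r ≤ p) → (0 < 1 - p → r ≤ 1 - p) →
      minBias p = r := by
    intro r hr hrp h2 h3
    refine IsLeast.csInf_eq ⟨⟨hr, hrp⟩, ?_⟩
    rintro s ⟨hs, rfl | rfl⟩
    · exact h2 hs
    · exact h3 hs
  rcases h0.eq_or_lt with rfl | h0
  · have := key 1 one_pos (by simp) (fun h => absurd h (lt_irrefl _)) (by simp)
    exact ⟨false, by simp [digitProb, this], by simp [digitProb, this], Or.inl this⟩
  rcases h1.eq_or_lt with rfl | h1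
  · have := key 1 one_pos (by simp) (by simp) (fun h => by simp at h)
    exact ⟨true, by simp [digitProb, this], by simp [digitProb, this], Or.inl this⟩
  rcases le_total p (1 - p) with h | h
  · have := key p h0 (by simp) (by simp) (fun _ => h)
    exact ⟨true, by simp [digitProb, this], by simp [digitProb, this],
      Or.inr (by simp only [this]; exact ⟨h0, by linarith⟩)⟩
  · have := key (1 - p) (by linarith) (by simp) (fun _ => h) (by simp)
    exact ⟨false, by simp [digitProb, this], by simp [digitProb, this],
      Or.inr (by simp only [this]; exact ⟨by linarith, by linarith⟩)⟩

lemma minBias_pos (p : unitInterval) : 0 < minBias p := by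
  obtain ⟨_, _, _, h | h⟩ := minBias_cases p
  · rw [h]; exact one_pos
  · exact h.1

lemma prod_map_bool {A : Type*} [CommMonoid A] (f : Bool → A) (d : Bool) (w : List Bool) :
    (w.map f).prod = f d ^ w.count d * f (!d) ^ w.count (!d) := by
  induction w with
  | nil => simp
  | cons c w ih =>
    rw [List.map_cons, List.prod_cons, ih]
    cases c <;> cases d <;> simp [pow_succ] <;> ac_rfl

/-- Here `M = 1`, so the general bound `M + 2^l` is too weak; but the measure is a point mass and
every ceiling is exact. -/
lemma ceilTotal_bernoulliSeq_of_minBias_eq_one {p : unitInterval} (h : minBias p = 1) (l : ℕ) :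
    (ceilTotal (bernoulliSeq p) l 1 : ℝ) = 1 := by
  obtain ⟨d, h1, h2, _⟩ := minBias_cases p
  rw [h] at h1 h2
  refine Eq.trans ?_ (sum_cyl (bernoulliSeq p) l)
  rw [ceilTotal]
  push_cast
  refine Finset.sum_congr rfl fun v _ => ?_
  rw [bernoulliSeq_real_cyl, prod_map_bool _ d, h1, h2, one_pow, one_mul, one_mul, sub_self]
  rcases Nat.eq_zero_or_pos ((List.ofFn v).count (!d)) with h | h
  · simp [h]
  · simp [zero_pow h.ne']

theorem isGeneric_bernoulliChampernowne (p : unitInterval) {ord : ℕ → List (List Bool)}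
    (hord : IsWordOrdering ord) :
    IsGeneric (bernoulliChampernowne p ord) (bernoulliSeq p) := by
  have hm := minBias_pos p
  refine isGeneric_champSeq hord (measurePreserving_shift_bernoulliSeq p)
    (fun i => by positivity) (fun i => by positivity) ?_ ?_
  · intro ε hε
    obtain ⟨_, _, _, h | h⟩ := minBias_cases p
    · refine Eventually.of_forall fun i => ?_
      simp only [h, one_pow, inv_one, ceilTotal_bernoulliSeq_of_minBias_eq_one h]
      linarith
    · have hA : ∀ᶠ i : ℕ in atTop, (4 : ℝ) ^ i ≤ (minBias p ^ (2 * i))⁻¹ := by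
        refine Eventually.of_forall fun i => ?_
        rw [pow_mul, ← inv_pow]
        refine pow_le_pow_left₀ (by norm_num) ?_ i
        rw [le_inv_comm₀ (by norm_num) (by positivity)]
        nlinarith [h.1, h.2]
      filter_upwards [eventually_two_pow_le hA hε] with i hi
      have := ceilTotal_le (bernoulliSeq p) i (M := (minBias p ^ (2 * i))⁻¹) (by positivity)
      linarith
  -- The ratio `M_{i+1} / M_i` is the constant `minBias⁻²`, while `ℓ_i → ∞`.
  · intro ε hε
    filter_upwards [tendsto_natCast_atTop_atTop.eventually_ge_atTop ((minBias p ^ 2)⁻¹ / ε),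
      eventually_ge_atTop 1] with i h1 h2
    have h3 : (i : ℝ) ≤ ((i ^ (2 * i) : ℕ) : ℝ) := by
      exact_mod_cast Nat.le_self_pow (by omega) i
    rw [div_le_iff₀ hε] at h1
    have h4 : (minBias p ^ 2)⁻¹ ≤ ε * ((i ^ (2 * i) : ℕ) : ℝ) := by nlinarith
    rw [mul_add, pow_add, mul_inv, mul_one, mul_comm, ← mul_assoc]
    exact mul_le_mul_of_nonneg_right h4 (by positivity)

/-! ### Computability tools -/

lemma primrec_nat_pow : Primrec₂ ((· ^ ·) : ℕ → ℕ → ℕ) :=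
  Primrec₂.unpaired'.1 Nat.Primrec.pow

lemma primrec_int_ofNat : Primrec fun n : ℕ => (n : ℤ) := by
  refine Primrec.encode_iff.1 ?_
  exact Primrec.nat_double.of_eq fun n => rfl

lemma primrec_int_toNat : Primrec Int.toNat := by
  refine Primrec.ofNat_iff.2 ?_
  -- The encoding of the integers puts the nonnegative ones at even codes and the negative ones at
  -- odd codes.
  have h : Primrec fun n : ℕ => if n % 2 = 0 then n / 2 else 0 :=
    Primrec.ite (Primrec.eq.comp (Primrec.nat_mod.comp Primrec.id (Primrec.const 2))
      (Primrec.const 0)) (Primrec.nat_div.comp Primrec.id (Primrec.const 2)) (Primrec.const 0)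
  refine h.of_eq fun n => ?_
  obtain ⟨z, rfl⟩ : ∃ z : ℤ, n = Encodable.encode z :=
    ⟨Denumerable.ofNat ℤ n, (Denumerable.encode_ofNat n).symm⟩
  rw [Denumerable.ofNat_encode]
  cases z with
  | ofNat k =>
    have : Encodable.encode (Int.ofNat k) = 2 * k := rfl
    rw [this]
    simp
  | negSucc k =>
    have : Encodable.encode (Int.negSucc k) = 2 * k + 1 := rfl
    rw [this, if_neg (by omega)]
    rfl

lemma computable_find {α : Type*} [Primcodable α] {R : α → ℕ → Bool} (hR : Computable₂ R)
    (h : ∀ a, ∃ n, R a n = true) : Computable fun a => Nat.find (h a) := by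
  refine (Partrec.rfind hR.partrec₂).of_eq_tot fun a => ?_
  rw [Nat.mem_rfind]
  refine ⟨by simpa using (Nat.find_spec (h a)).symm, fun {k} hk => ?_⟩
  have := Nat.find_min (h a) hk
  simpa using (Bool.eq_false_iff.2 this).symm

/-- Unbounded search over pairs of a candidate answer and a certificate, keeping only the answer. -/
lemma exists_computable_of_exists {α : Type*} [Primcodable α] {R : α → ℕ × ℕ → Bool}
    (hR : Computable₂ R) (h : ∀ a, ∃ n, R a n = true) :
    ∃ F : α → ℕ, Computable F ∧ ∀ a, ∃ e, R a (F a, e) = true := by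
  have hR' : Computable₂ fun (a : α) (n : ℕ) => R a n.unpair :=
    hR.comp Computable.fst (Computable.unpair.comp Computable.snd)
  have h' : ∀ a, ∃ n : ℕ, R a n.unpair = true := fun a => by
    obtain ⟨⟨k, e⟩, hk⟩ := h a
    exact ⟨Nat.pair k e, by simpa using hk⟩
  refine ⟨fun a => (Nat.find (h' a)).unpair.1,
    Computable.fst.comp (Computable.unpair.comp (computable_find hR' h')), fun a => ?_⟩
  exact ⟨(Nat.find (h' a)).unpair.2, Nat.find_spec (h' a)⟩

lemma computable_list_map {α β σ : Type*} [Primcodable α] [Primcodable β] [Primcodable σ]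
    {f : α → List β} {g : α → β → σ} (hf : Computable f) (hg : Computable₂ g) :
    Computable fun a => (f a).map (g a) := by
  have hstep : Computable₂ fun (a : α) (q : ℕ × List σ) =>
      (Option.casesOn ((f a)[q.1]?) q.2 fun b => q.2 ++ [g a b] : List σ) := by
    refine Computable.option_casesOn
      (Computable.list_getElem?.comp (hf.comp Computable.fst)
        (Computable.fst.comp Computable.snd)) (Computable.snd.comp Computable.snd) ?_
    exact Computable.list_concat.comp
      (Computable.snd.comp (Computable.snd.comp Computable.fst))
      (hg.comp (Computable.fst.comp Computable.fst) Computable.snd)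
  refine (Computable.nat_rec (Computable.list_length.comp hf) (Computable.const []) hstep).of_eq
    fun a => ?_
  suffices h : ∀ k, (Nat.rec [] (fun k acc =>
      (Option.casesOn ((f a)[k]?) acc fun b => acc ++ [g a b] : List σ)) k : List σ) =
      ((f a).take k).map (g a) by
    rw [h, List.take_length]
  intro k
  induction k with
  | zero => simp
  | succ k ih =>
    simp only [ih, List.take_add_one]
    cases (f a)[k]? <;> simp

lemma computable_list_flatMap {α β σ : Type*} [Primcodable α] [Primcodable β] [Primcodable σ]
    {f : α → List β} {g : α → β → List σ} (hf : Computable f) (hg : Computable₂ g) :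
    Computable fun a => (f a).flatMap (g a) := by
  simp only [List.flatMap_def]
  exact Primrec.list_flatten.to_comp.comp (computable_list_map hf hg)

lemma primrec_wpow : Primrec₂ wpow := by
  have h : Primrec₂ fun (w : List Bool) (k : ℕ) => ((List.range k).map fun _ => w).flatten :=
    Primrec.list_flatten.comp (Primrec.list_map (Primrec.list_range.comp Primrec.snd)
      (Primrec.fst.comp Primrec.fst))
  exact h.of_eq fun w k => by simp [wpow]

lemma primrec_count (d : Bool) : Primrec fun w : List Bool => w.count d := by
  have h : Primrec fun w : List Bool => (w.filter (· = d)).length :=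
    Primrec.list_length.comp (Primrec.listFilter (Primrec.eq.comp Primrec.id (Primrec.const d)))
  exact h.of_eq fun w => by
    rw [List.count_eq_length_filter]; rfl

/-! ### Computable reals in the unit interval -/

lemma IsComputableReal.exists_nat {a : ℝ} (h : IsComputableReal a) (h0 : 0 ≤ a) :
    ∃ f : ℕ → ℕ, Computable f ∧ ∀ n : ℕ, |a - (f n : ℝ) / 2 ^ n| ≤ 1 / 2 ^ n := by
  obtain ⟨f, hf, hfa⟩ := h
  refine ⟨fun n => (f n).toNat, primrec_int_toNat.to_comp.comp hf, fun n => ?_⟩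
  have hn := hfa n
  rcases le_total 0 (f n) with h | h
  · have : (((f n).toNat : ℕ) : ℝ) = (f n : ℝ) := by
      have := Int.toNat_of_nonneg h
      exact_mod_cast this
    rwa [this]
  · simp only [Int.toNat_of_nonpos h]
    have h1 : (f n : ℝ) / 2 ^ n ≤ 0 :=
      div_nonpos_of_nonpos_of_nonneg (by exact_mod_cast h) (by positivity)
    rw [abs_le] at hn ⊢
    rw [Nat.cast_zero, zero_div, sub_zero]
    constructor <;> linarith [hn.1, hn.2]

lemma IsComputableReal.of_nat {a : ℝ} {f : ℕ → ℕ} (hf : Computable f)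
    (h : ∀ n : ℕ, |a - (f n : ℝ) / 2 ^ n| ≤ 1 / 2 ^ n) : IsComputableReal a :=
  ⟨fun n => f n, primrec_int_ofNat.to_comp.comp hf, fun n => by simpa using h n⟩

lemma IsComputableReal.one_sub {a : ℝ} (h : IsComputableReal a) (h0 : 0 ≤ a) (h1 : a ≤ 1) :
    IsComputableReal (1 - a) := by
  obtain ⟨f, hf, hfa⟩ := h.exists_nat h0
  refine IsComputableReal.of_nat (f := fun n => 2 ^ n - f n) ?_ fun n => ?_
  · exact Primrec.nat_sub.to_comp.comp
      (primrec_nat_pow.to_comp.comp (Computable.const 2) Computable.id) hf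
  · have hn := hfa n
    have h2 : (0 : ℝ) < 2 ^ n := by positivity
    rcases le_total (f n) (2 ^ n) with h | h
    · rw [Nat.cast_sub h, Nat.cast_pow, Nat.cast_ofNat, sub_div, div_self h2.ne', ← abs_neg]
      convert hn using 2
      ring
    · rw [Nat.sub_eq_zero_of_le h]
      have h3 : 1 ≤ (f n : ℝ) / 2 ^ n := by
        rw [le_div_iff₀ h2, one_mul]; exact_mod_cast h
      rw [abs_le] at hn ⊢
      simp only [Nat.cast_zero, zero_div, sub_zero]
      constructor <;> linarith [hn.1, hn.2]

/-- Dyadic bounds of a computable real. -/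
lemma IsComputableReal.exists_bounds {a : ℝ} (h : IsComputableReal a) (h0 : 0 ≤ a) :
    ∃ L U : ℕ → ℕ, Computable L ∧ Computable U ∧
      (∀ n, (L n : ℝ) / 2 ^ n ≤ a) ∧ (∀ n, a ≤ (U n : ℝ) / 2 ^ n) ∧
      Tendsto (fun n => (L n : ℝ) / 2 ^ n) atTop (𝓝 a) ∧
      Tendsto (fun n => (U n : ℝ) / 2 ^ n) atTop (𝓝 a) := by
  obtain ⟨f, hf, hfa⟩ := h.exists_nat h0
  have ht : Tendsto (fun n : ℕ => (2 : ℝ) * (1 / 2 ^ n)) atTop (𝓝 0) := by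
    have := (tendsto_pow_atTop_nhds_zero_of_lt_one (r := (1 / 2 : ℝ)) (by norm_num)
      (by norm_num)).const_mul 2
    simpa using this
  have hLn : ∀ n, (((f n - 1 : ℕ) : ℝ)) / 2 ^ n ≤ a ∧ a - 2 * (1 / 2 ^ n) ≤
      (((f n - 1 : ℕ) : ℝ)) / 2 ^ n := by
    intro n
    have hn := abs_le.1 (hfa n)
    have h2 : (0 : ℝ) < 2 ^ n := by positivity
    rcases Nat.eq_zero_or_pos (f n) with h | h
    · rw [h] at hn ⊢
      simp at hn ⊢
      have : (0 : ℝ) < (2 ^ n)⁻¹ := by positivity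
      constructor <;> linarith [hn.1, hn.2]
    · rw [Nat.cast_sub h, Nat.cast_one, sub_div]
      constructor <;> linarith [hn.1, hn.2]
  have hUn : ∀ n, a ≤ (((f n + 1 : ℕ) : ℝ)) / 2 ^ n ∧
      (((f n + 1 : ℕ) : ℝ)) / 2 ^ n ≤ a + 2 * (1 / 2 ^ n) := by
    intro n
    have hn := abs_le.1 (hfa n)
    rw [Nat.cast_add, Nat.cast_one, add_div]
    constructor <;> linarith [hn.1, hn.2]
  refine ⟨fun n => f n - 1, fun n => f n + 1,
    Primrec.nat_sub.to_comp.comp hf (Computable.const 1), Computable.succ.comp hf,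
    fun n => (hLn n).1, fun n => (hUn n).1, ?_, ?_⟩
  · refine tendsto_of_tendsto_of_tendsto_of_le_of_le (by simpa using tendsto_const_nhds.sub ht)
      tendsto_const_nhds (fun n => (hLn n).2) fun n => (hLn n).1
  · refine tendsto_of_tendsto_of_tendsto_of_le_of_le tendsto_const_nhds
      (by simpa using tendsto_const_nhds.add ht) (fun n => (hUn n).1) fun n => (hUn n).2

/-! ### Inverting the binary entropy -/

lemma entropy₂_eq (p : ℝ) : entropy₂ p = Real.binEntropy p / Real.log 2 := by
  rw [entropy₂, Real.binEntropy_eq_negMulLog_add_negMulLog_one_sub]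
  simp only [Real.logb, Real.negMulLog]
  ring

lemma entropy₂_one_sub (p : ℝ) : entropy₂ (1 - p) = entropy₂ p := by
  rw [entropy₂_eq, entropy₂_eq, Real.binEntropy_one_sub]

lemma strictMonoOn_entropy₂ : StrictMonoOn entropy₂ (Set.Icc 0 (1 / 2)) := by
  intro x hx y hy hxy
  rw [one_div] at hx hy
  rw [entropy₂_eq, entropy₂_eq]
  exact div_lt_div_of_pos_right (Real.binEntropy_strictMonoOn hx hy hxy) (Real.log_pos one_lt_two)

lemma exists_entropy₂_eq {α : ℝ} (hα : α ∈ Set.Icc (0 : ℝ) 1) :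
    ∃ p : unitInterval, entropy₂ p = α := by
  have hc : Continuous entropy₂ := by
    rw [funext entropy₂_eq]
    exact Real.binEntropy_continuous.div_const _
  have h := intermediate_value_Icc (show (0 : ℝ) ≤ 2⁻¹ by norm_num) hc.continuousOn
  have h0 : entropy₂ 0 = 0 := by simp [entropy₂_eq]
  have h1 : entropy₂ 2⁻¹ = 1 := by
    rw [entropy₂_eq, Real.binEntropy_two_inv, div_self (Real.log_pos one_lt_two).ne']
  rw [h0, h1] at h
  obtain ⟨p, hp, rfl⟩ := h hα
  exact ⟨⟨p, hp.1, hp.2.trans (by norm_num)⟩, rfl⟩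

/-- At `x = 0` the conventions `0 log 0 = 0` and `0 ^ 0 = 1` agree, so exponentiating the entropy at
a fraction gives natural numbers. -/
lemma mul_logb_div (x N : ℕ) (hN : 0 < N) :
    (N : ℝ) * ((x / N : ℝ) * Real.logb 2 (x / N)) =
      Real.logb 2 ((x ^ x : ℕ) : ℝ) - x * Real.logb 2 N := by
  have hN' : (N : ℝ) ≠ 0 := by positivity
  rw [Nat.cast_pow, Real.logb_pow]
  rcases Nat.eq_zero_or_pos x with rfl | hx
  · simp
  · rw [Real.logb_div (by positivity) hN']
    field_simp

lemma logb_entropy_sub {N j K A : ℕ} (hN : 0 < N) (hj : j ≤ N) (hK : 0 < K) :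
    Real.logb 2 ((N ^ (N * K) : ℕ) : ℝ) -
      Real.logb 2 ((2 ^ (A * N) * (j ^ j * (N - j) ^ (N - j)) ^ K : ℕ) : ℝ) =
      N * K * (entropy₂ (j / N) - A / K) := by
  have hN' : (N : ℝ) ≠ 0 := by positivity
  have hK' : (K : ℝ) ≠ 0 := by positivity
  have hx : ∀ x : ℕ, ((x ^ x : ℕ) : ℝ) ≠ 0 := fun x => by
    exact_mod_cast (Nat.pow_self_pos (n := x)).ne'
  have h1 := mul_logb_div j N hN
  have h2 := mul_logb_div (N - j) N hN
  have h3 : (1 : ℝ) - j / N = ((N - j : ℕ) : ℝ) / N := by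
    rw [Nat.cast_sub hj]; field_simp
  have h4 : (N : ℝ) * entropy₂ (j / N) = N * Real.logb 2 N -
      Real.logb 2 ((j ^ j : ℕ) : ℝ) - Real.logb 2 (((N - j) ^ (N - j) : ℕ) : ℝ) := by
    rw [entropy₂, h3]
    rw [Nat.cast_sub hj] at h2 ⊢
    linear_combination -h1 - h2
  have h5 : (N : ℝ) * K * (entropy₂ (j / N) - A / K) = K * (N * entropy₂ (j / N)) - A * N := by
    field_simp
  rw [h5, h4, Nat.cast_mul (2 ^ (A * N)), Nat.cast_pow _ K, Nat.cast_mul (j ^ j),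
    Real.logb_mul (by positivity) (pow_ne_zero _ (mul_ne_zero (hx _) (hx _))),
    Real.logb_pow, Real.logb_mul (hx _) (hx _), Nat.cast_pow N, Real.logb_pow, Nat.cast_pow 2,
    Real.logb_pow, Nat.cast_ofNat, Real.logb_self_eq_one one_lt_two]
  push_cast
  ring

lemma entropy₂_lt_iff {N j K A : ℕ} (hN : 0 < N) (hj : j ≤ N) (hK : 0 < K) :
    entropy₂ (j / N) < A / K ↔
      N ^ (N * K) < 2 ^ (A * N) * (j ^ j * (N - j) ^ (N - j)) ^ K := by
  have h := logb_entropy_sub (A := A) hN hj hK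
  have hpos : 0 < 2 ^ (A * N) * (j ^ j * (N - j) ^ (N - j)) ^ K := by
    have h1 := Nat.pow_self_pos (n := j)
    have h2 := Nat.pow_self_pos (n := N - j)
    positivity
  have hNK : (0 : ℝ) < N * K := by positivity
  rw [← Nat.cast_lt (α := ℝ), iff_comm, ← Real.logb_lt_logb_iff one_lt_two (by positivity)
    (by exact_mod_cast hpos), ← sub_neg, h, ← neg_pos, ← mul_neg,
    mul_pos_iff_of_pos_left hNK, neg_pos, sub_neg]

lemma lt_entropy₂_iff {N j K A : ℕ} (hN : 0 < N) (hj : j ≤ N) (hK : 0 < K) :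
    A / K < entropy₂ (j / N) ↔
      2 ^ (A * N) * (j ^ j * (N - j) ^ (N - j)) ^ K < N ^ (N * K) := by
  have h := logb_entropy_sub (A := A) hN hj hK
  have hpos : 0 < 2 ^ (A * N) * (j ^ j * (N - j) ^ (N - j)) ^ K := by
    have h1 := Nat.pow_self_pos (n := j)
    have h2 := Nat.pow_self_pos (n := N - j)
    positivity
  have hNK : (0 : ℝ) < N * K := by positivity
  rw [← Nat.cast_lt (α := ℝ), iff_comm, ← Real.logb_lt_logb_iff one_lt_two
    (by exact_mod_cast hpos) (by positivity), ← sub_pos, h, mul_pos_iff_of_pos_left hNK, sub_pos]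

/-- The test that the entropy at `(j-1)/2ⁿ` is below `a/2^k`, and that at `(j+1)/2ⁿ` above
`c/2^k` (where these points lie in `[0, 1/2]`). -/
def entropyTest (n j k a c : ℕ) : Prop :=
  2 * j ≤ 2 ^ n ∧
  (j = 0 ∨ (2 ^ n) ^ (2 ^ n * 2 ^ k) <
    2 ^ (a * 2 ^ n) * ((j - 1) ^ (j - 1) * (2 ^ n - (j - 1)) ^ (2 ^ n - (j - 1))) ^ 2 ^ k) ∧
  (2 ^ n < 2 * (j + 1) ∨ 2 ^ (c * 2 ^ n) *
    ((j + 1) ^ (j + 1) * (2 ^ n - (j + 1)) ^ (2 ^ n - (j + 1))) ^ 2 ^ k <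
      (2 ^ n) ^ (2 ^ n * 2 ^ k))

instance (n j k a c : ℕ) : Decidable (entropyTest n j k a c) := by
  unfold entropyTest; infer_instance

lemma entropyTest_iff (n j k a c : ℕ) : entropyTest n j k a c ↔ 2 * j ≤ 2 ^ n ∧
    (j = 0 ∨ entropy₂ (((j - 1 : ℕ) : ℝ) / 2 ^ n) < (a : ℝ) / 2 ^ k) ∧
    (2 ^ n < 2 * (j + 1) ∨ (c : ℝ) / 2 ^ k < entropy₂ (((j + 1 : ℕ) : ℝ) / 2 ^ n)) := by
  have hn : 0 < 2 ^ n := by positivity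
  have hk : 0 < 2 ^ k := by positivity
  unfold entropyTest
  refine and_congr_right fun hj => and_congr (or_congr_right ?_) (or_congr_right' fun hj' => ?_)
  · rw [← entropy₂_lt_iff hn (by omega) hk]
    push_cast; rfl
  · rw [← lt_entropy₂_iff hn (by omega) hk]
    push_cast; rfl

/-- The Boolean version of `entropyTest`. -/
def entropyCheck (q : ℕ × ℕ × ℕ × ℕ × ℕ) : Bool :=
  decide (entropyTest q.1 q.2.1 q.2.2.1 q.2.2.2.1 q.2.2.2.2)

lemma primrec_entropyCheck : Primrec entropyCheck := by
  refine PrimrecPred.decide ?_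
  have pw : ∀ {f g : ℕ × ℕ × ℕ × ℕ × ℕ → ℕ}, Primrec f → Primrec g →
    Primrec fun q => f q ^ g q := fun hf hg => primrec_nat_pow.comp hf hg
  have ml : ∀ {f g : ℕ × ℕ × ℕ × ℕ × ℕ → ℕ}, Primrec f → Primrec g →
    Primrec fun q => f q * g q := fun hf hg => Primrec.nat_mul.comp hf hg
  have sb : ∀ {f g : ℕ × ℕ × ℕ × ℕ × ℕ → ℕ}, Primrec f → Primrec g →
    Primrec fun q => f q - g q := fun hf hg => Primrec.nat_sub.comp hf hg
  have hn : Primrec fun q : ℕ × ℕ × ℕ × ℕ × ℕ => 2 ^ q.1 := pw (Primrec.const 2) Primrec.fst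
  have hj : Primrec fun q : ℕ × ℕ × ℕ × ℕ × ℕ => q.2.1 := Primrec.fst.comp Primrec.snd
  have hk : Primrec fun q : ℕ × ℕ × ℕ × ℕ × ℕ => 2 ^ q.2.2.1 :=
    pw (Primrec.const 2) (Primrec.fst.comp (Primrec.snd.comp Primrec.snd))
  have ha : Primrec fun q : ℕ × ℕ × ℕ × ℕ × ℕ => q.2.2.2.1 :=
    Primrec.fst.comp (Primrec.snd.comp (Primrec.snd.comp Primrec.snd))
  have hc : Primrec fun q : ℕ × ℕ × ℕ × ℕ × ℕ => q.2.2.2.2 :=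
    Primrec.snd.comp (Primrec.snd.comp (Primrec.snd.comp Primrec.snd))
  have hj1 := sb hj (Primrec.const 1)
  have hj2 : Primrec fun q : ℕ × ℕ × ℕ × ℕ × ℕ => q.2.1 + 1 := Primrec.succ.comp hj
  have hpow : ∀ {f : ℕ × ℕ × ℕ × ℕ × ℕ → ℕ}, Primrec f → Primrec fun q =>
      (f q ^ f q * (2 ^ q.1 - f q) ^ (2 ^ q.1 - f q)) ^ 2 ^ q.2.2.1 := fun hf =>
    pw (ml (pw hf hf) (pw (sb hn hf) (sb hn hf))) hk
  refine PrimrecPred.and (Primrec.nat_le.comp (ml (Primrec.const 2) hj) hn)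
    (PrimrecPred.and (PrimrecPred.or (Primrec.eq.comp hj (Primrec.const 0)) ?_)
      (PrimrecPred.or (Primrec.nat_lt.comp hn (ml (Primrec.const 2) hj2)) ?_))
  · exact Primrec.nat_lt.comp (pw hn (ml hn hk))
      (ml (pw (Primrec.const 2) (ml ha hn)) (hpow hj1))
  · exact Primrec.nat_lt.comp (ml (pw (Primrec.const 2) (ml hc hn)) (hpow hj2))
      (pw hn (ml hn hk))

/-- Comparing `p` with `j / 2ⁿ` itself may never be settled. Testing the neighbours `j ± 1` leaves
slack: some `j` passes with strict inequalities, which sufficiently good approximations to the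
entropy confirm, and any `j` that passes is within `1 / 2ⁿ` of `p`. -/
lemma isComputableReal_of_entropy₂_of_le_half {p : ℝ} (hp0 : 0 ≤ p) (hp : p ≤ 1 / 2)
    (h : IsComputableReal (entropy₂ p)) (he : 0 ≤ entropy₂ p) : IsComputableReal p := by
  obtain ⟨L, U, hL, hU, hLle, hUle, hLt, hUt⟩ := h.exists_bounds he
  have hR : Computable₂ fun (n : ℕ) (q : ℕ × ℕ) =>
      entropyCheck (n, q.1, q.2, L q.2, U q.2) := by
    have hq1 : Computable fun r : ℕ × ℕ × ℕ => r.2.1 := Computable.fst.comp Computable.snd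
    have hq2 : Computable fun r : ℕ × ℕ × ℕ => r.2.2 := Computable.snd.comp Computable.snd
    exact primrec_entropyCheck.to_comp.comp (Computable.fst.pair (hq1.pair (hq2.pair
      ((hL.comp hq2).pair (hU.comp hq2)))))
  have hmem : ∀ {x : ℝ}, 0 ≤ x → x ≤ 1 / 2 → x ∈ Set.Icc (0 : ℝ) (1 / 2) := fun h h' => ⟨h, h'⟩
  have hpm := hmem hp0 hp
  have hhalf : ∀ (n i : ℕ), 2 * i ≤ 2 ^ n → (i : ℝ) / 2 ^ n ≤ 1 / 2 := by
    intro n i hi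
    rw [div_le_div_iff₀ (by positivity) (by norm_num)]
    have : (2 : ℝ) * i ≤ 2 ^ n := by exact_mod_cast hi
    linarith
  have hex : ∀ n, ∃ q : ℕ × ℕ, entropyCheck (n, q.1, q.2, L q.2, U q.2) = true := by
    intro n
    have h2 : (0 : ℝ) < 2 ^ n := by positivity
    set j := ⌊p * 2 ^ n⌋₊ with hj
    have hj1 : (j : ℝ) ≤ p * 2 ^ n := Nat.floor_le (by positivity)
    have hj2 : p * 2 ^ n < ((j + 1 : ℕ) : ℝ) := by
      rw [Nat.cast_add_one]
      exact Nat.lt_floor_add_one _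
    have hjn : 2 * j ≤ 2 ^ n := by
      have : (2 : ℝ) * j ≤ 2 ^ n := by nlinarith
      exact_mod_cast this
    have e1 : ∀ᶠ k in atTop,
        j = 0 ∨ entropy₂ (((j - 1 : ℕ) : ℝ) / 2 ^ n) < (L k : ℝ) / 2 ^ k := by
      rcases Nat.eq_zero_or_pos j with h0 | h0
      · exact Eventually.of_forall fun _ => Or.inl h0
      · have hlt : ((j - 1 : ℕ) : ℝ) / 2 ^ n < p := by
          rw [div_lt_iff₀ h2]
          have : ((j - 1 : ℕ) : ℝ) < j := by exact_mod_cast (by omega : j - 1 < j)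
          linarith
        have := strictMonoOn_entropy₂ (hmem (by positivity) (hlt.le.trans hp)) hpm hlt
        exact (hLt.eventually_const_lt this).mono fun _ h => Or.inr h
    have e2 : ∀ᶠ k in atTop,
        2 ^ n < 2 * (j + 1) ∨ (U k : ℝ) / 2 ^ k < entropy₂ (((j + 1 : ℕ) : ℝ) / 2 ^ n) := by
      by_cases h0 : 2 ^ n < 2 * (j + 1)
      · exact Eventually.of_forall fun _ => Or.inl h0
      · have hlt : p < ((j + 1 : ℕ) : ℝ) / 2 ^ n := by rwa [lt_div_iff₀ h2]
        have := strictMonoOn_entropy₂ hpm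
          (hmem (by positivity) (hhalf n (j + 1) (by omega))) hlt
        exact (hUt.eventually_lt_const this).mono fun _ h => Or.inr h
    obtain ⟨k, hk1, hk2⟩ := (e1.and e2).exists
    exact ⟨(j, k), decide_eq_true ((entropyTest_iff _ _ _ _ _).2 ⟨hjn, hk1, hk2⟩)⟩
  obtain ⟨f, hf, hfe⟩ := exists_computable_of_exists hR hex
  refine IsComputableReal.of_nat hf fun n => ?_
  obtain ⟨k, hk⟩ := hfe n
  obtain ⟨h1, h2, h3⟩ := (entropyTest_iff _ _ _ _ _).1 (of_decide_eq_true hk)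
  simp only at h1 h2 h3
  set j := f n
  have h2n : (0 : ℝ) < 2 ^ n := by positivity
  have hlow : ((j : ℝ) - 1) / 2 ^ n ≤ p := by
    rcases Nat.eq_zero_or_pos j with h0 | h0
    · rw [h0]
      refine le_trans (div_nonpos_of_nonpos_of_nonneg ?_ h2n.le) hp0
      simp
    · have h2' := (h2.resolve_left h0.ne').trans_le (hLle k)
      have := (strictMonoOn_entropy₂.lt_iff_lt
        (hmem (by positivity) (hhalf n (j - 1) (by omega))) hpm).1 h2'
      rw [Nat.cast_sub h0, Nat.cast_one] at this
      exact this.le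
  have hup : p ≤ ((j : ℝ) + 1) / 2 ^ n := by
    by_cases h0 : 2 ^ n < 2 * (j + 1)
    · refine hp.trans ?_
      rw [div_le_div_iff₀ (by norm_num) h2n]
      have : (2 : ℝ) ^ n < 2 * (j + 1) := by exact_mod_cast h0
      linarith
    · have h3' := (hUle k).trans_lt (h3.resolve_left h0)
      have := (strictMonoOn_entropy₂.lt_iff_lt hpm
        (hmem (by positivity) (hhalf n (j + 1) (by omega)))).1 h3'
      rw [Nat.cast_add, Nat.cast_one] at this
      exact this.le
  rw [sub_div] at hlow
  rw [add_div] at hup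
  rw [abs_le]
  constructor <;> linarith

theorem isComputableReal_of_entropy₂ {p : ℝ} (hp : p ∈ Set.Icc (0 : ℝ) 1)
    (h : IsComputableReal (entropy₂ p)) : IsComputableReal p := by
  have he : 0 ≤ entropy₂ p := by
    rw [entropy₂_eq]
    exact div_nonneg (Real.binEntropy_nonneg hp.1 hp.2) (Real.log_nonneg one_lt_two.le)
  rcases le_total p (1 / 2) with h2 | h2
  · exact isComputableReal_of_entropy₂_of_le_half hp.1 h2 h he
  · rw [← entropy₂_one_sub] at h he
    have := (isComputableReal_of_entropy₂_of_le_half (by linarith [hp.2]) (by linarith)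
      h he).one_sub (by linarith [hp.2]) (by linarith [hp.1])
    rwa [sub_sub_cancel] at this

/-! ### Computing the ceilings of the products `m⁻ˢ (1 - m)ᵗ` -/

/-- The projection to the second coordinate and the kernel of that projection are both cyclic. A
generator may be `0`. -/
lemma exists_generators (G : AddSubgroup (ℤ × ℤ)) :
    ∃ x y e : ℤ, (x, y) ∈ G ∧ (e, 0) ∈ G ∧
      ∀ s t, (s, t) ∈ G → ∃ u v : ℤ, t = y * u ∧ s = x * u + e * v := by
  obtain ⟨y, hy⟩ := Int.subgroup_cyclic (G.map (AddMonoidHom.snd ℤ ℤ))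
  obtain ⟨e, he⟩ := Int.subgroup_cyclic (G.comap (AddMonoidHom.inl ℤ ℤ))
  have hy' : y ∈ G.map (AddMonoidHom.snd ℤ ℤ) := hy ▸ AddSubgroup.subset_closure rfl
  have he' : e ∈ G.comap (AddMonoidHom.inl ℤ ℤ) := he ▸ AddSubgroup.subset_closure rfl
  obtain ⟨⟨x, y'⟩, hx, rfl⟩ := hy'
  refine ⟨x, y', e, hx, he', fun s t hst => ?_⟩
  have ht : t ∈ G.map (AddMonoidHom.snd ℤ ℤ) := ⟨(s, t), hst, rfl⟩
  rw [hy, AddSubgroup.mem_closure_singleton] at ht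
  obtain ⟨u, hu⟩ := ht
  simp only [AddMonoidHom.coe_snd, smul_eq_mul] at hu
  have hs : s - u * x ∈ G.comap (AddMonoidHom.inl ℤ ℤ) := by
    have := G.sub_mem hst (G.zsmul_mem hx u)
    simpa [hu] using this
  rw [he, AddSubgroup.mem_closure_singleton] at hs
  obtain ⟨v, hv⟩ := hs
  rw [smul_eq_mul] at hv
  exact ⟨u, v, by rw [← hu, mul_comm], by linarith⟩

/-- The exponents `(s, t)` for which `c^s d^t` is rational. -/
def ratExponents {c d : ℝ} (hc : c ≠ 0) (hd : d ≠ 0) : AddSubgroup (ℤ × ℤ) where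
  carrier := {z | ∃ q : ℚ, c ^ z.1 * d ^ z.2 = q}
  zero_mem' := ⟨1, by simp⟩
  add_mem' := by
    rintro a b ⟨q, hq⟩ ⟨r, hr⟩
    refine ⟨q * r, ?_⟩
    rw [Prod.fst_add, Prod.snd_add, zpow_add₀ hc, zpow_add₀ hd, Rat.cast_mul, ← hq, ← hr]
    ring
  neg_mem' := by
    rintro a ⟨q, hq⟩
    refine ⟨q⁻¹, ?_⟩
    rw [Prod.fst_neg, Prod.snd_neg, zpow_neg, zpow_neg, Rat.cast_inv, ← hq, mul_inv]

lemma exists_nat_div {q : ℚ} (hq : 0 < q) : ∃ a b : ℕ, 0 < a ∧ 0 < b ∧ (q : ℝ) = a / b := by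
  have hnum : 0 < q.num := Rat.num_pos.2 hq
  refine ⟨q.num.toNat, q.den, by omega, q.den_pos, ?_⟩
  have h : ((q.num.toNat : ℕ) : ℝ) = (q.num : ℝ) := by
    have := Int.toNat_of_nonneg hnum.le
    exact_mod_cast this
  rw [h]
  exact_mod_cast (Rat.num_div_den q).symm

lemma exists_nat_sub (z : ℤ) : ∃ a b : ℕ, z = a - b :=
  ⟨z.toNat, (-z).toNat, by omega⟩

/-- A relation certifying that `c^s d^t` is a fraction with ceiling `k`. The parameters are
`x = x₁ - x₂`, `y = y₁ - y₂`, `e = e₁ - e₂` and fractions with `c^x d^y = a₁/b₁`, `c^e = a₂/b₂`. -/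
def RatCert (x₁ x₂ y₁ y₂ e₁ e₂ a₁ b₁ a₂ b₂ s t k u₁ u₂ v₁ v₂ : ℕ) : Prop :=
  s + (x₁ * u₂ + x₂ * u₁ + (e₁ * v₂ + e₂ * v₁)) = x₁ * u₁ + x₂ * u₂ + (e₁ * v₁ + e₂ * v₂) ∧
  t + (y₁ * u₂ + y₂ * u₁) = y₁ * u₁ + y₂ * u₂ ∧
  a₁ ^ u₁ * b₁ ^ u₂ * (a₂ ^ v₁ * b₂ ^ v₂) ≤ k * (b₁ ^ u₁ * a₁ ^ u₂ * (b₂ ^ v₁ * a₂ ^ v₂)) ∧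
  k * (b₁ ^ u₁ * a₁ ^ u₂ * (b₂ ^ v₁ * a₂ ^ v₂)) <
    a₁ ^ u₁ * b₁ ^ u₂ * (a₂ ^ v₁ * b₂ ^ v₂) + b₁ ^ u₁ * a₁ ^ u₂ * (b₂ ^ v₁ * a₂ ^ v₂)

instance (x₁ x₂ y₁ y₂ e₁ e₂ a₁ b₁ a₂ b₂ s t k u₁ u₂ v₁ v₂ : ℕ) :
    Decidable (RatCert x₁ x₂ y₁ y₂ e₁ e₂ a₁ b₁ a₂ b₂ s t k u₁ u₂ v₁ v₂) := by
  unfold RatCert; infer_instance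

lemma primrecPred_ratCert (x₁ x₂ y₁ y₂ e₁ e₂ a₁ b₁ a₂ b₂ : ℕ) {α : Type*} [Primcodable α]
    {s t k u₁ u₂ v₁ v₂ : α → ℕ} (hs : Primrec s) (ht : Primrec t) (hk : Primrec k)
    (hu₁ : Primrec u₁) (hu₂ : Primrec u₂) (hv₁ : Primrec v₁) (hv₂ : Primrec v₂) :
    PrimrecPred fun a =>
      RatCert x₁ x₂ y₁ y₂ e₁ e₂ a₁ b₁ a₂ b₂ (s a) (t a) (k a) (u₁ a) (u₂ a) (v₁ a) (v₂ a) := by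
  have pw : ∀ (c : ℕ) {g : α → ℕ}, Primrec g → Primrec fun q => c ^ g q :=
    fun c _ hg => primrec_nat_pow.comp (Primrec.const c) hg
  have cm : ∀ (c : ℕ) {g : α → ℕ}, Primrec g → Primrec fun q => c * g q :=
    fun c _ hg => Primrec.nat_mul.comp (Primrec.const c) hg
  have ml : ∀ {f g : α → ℕ}, Primrec f → Primrec g → Primrec fun q => f q * g q :=
    fun hf hg => Primrec.nat_mul.comp hf hg
  have ad : ∀ {f g : α → ℕ}, Primrec f → Primrec g → Primrec fun q => f q + g q :=
    fun hf hg => Primrec.nat_add.comp hf hg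
  have hA := ml (ml (pw a₁ hu₁) (pw b₁ hu₂)) (ml (pw a₂ hv₁) (pw b₂ hv₂))
  have hB := ml (ml (pw b₁ hu₁) (pw a₁ hu₂)) (ml (pw b₂ hv₁) (pw a₂ hv₂))
  refine PrimrecPred.and (Primrec.eq.comp ?_ ?_) (PrimrecPred.and (Primrec.eq.comp ?_ ?_)
    (PrimrecPred.and (Primrec.nat_le.comp hA (ml hk hB))
      (Primrec.nat_lt.comp (ml hk hB) (ad hA hB))))
  · exact ad hs (ad (ad (cm x₁ hu₂) (cm x₂ hu₁)) (ad (cm e₁ hv₂) (cm e₂ hv₁)))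
  · exact ad (ad (cm x₁ hu₁) (cm x₂ hu₂)) (ad (cm e₁ hv₁) (cm e₂ hv₂))
  · exact ad ht (ad (cm y₁ hu₂) (cm y₂ hu₁))
  · exact ad (cm y₁ hu₁) (cm y₂ hu₂)

lemma ratCert_iff {c d : ℝ} (hc : 0 < c) {x₁ x₂ y₁ y₂ e₁ e₂ a₁ b₁ a₂ b₂ : ℕ}
    (ha₁ : 0 < a₁) (hb₁ : 0 < b₁) (ha₂ : 0 < a₂) (hb₂ : 0 < b₂)
    (h₁ : c ^ ((x₁ : ℤ) - x₂) * d ^ ((y₁ : ℤ) - y₂) = (a₁ : ℝ) / b₁)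
    (h₂ : c ^ ((e₁ : ℤ) - e₂) = (a₂ : ℝ) / b₂) (s t k u₁ u₂ v₁ v₂ : ℕ) :
    RatCert x₁ x₂ y₁ y₂ e₁ e₂ a₁ b₁ a₂ b₂ s t k u₁ u₂ v₁ v₂ ↔
      ((s : ℤ) = (x₁ - x₂) * (u₁ - u₂) + (e₁ - e₂) * (v₁ - v₂) ∧
      (t : ℤ) = (y₁ - y₂) * (u₁ - u₂)) ∧ c ^ s * d ^ t ≤ k ∧ (k : ℝ) < c ^ s * d ^ t + 1 := by
  unfold RatCert
  rw [← and_assoc]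
  refine Iff.trans (and_congr_left' (and_congr ?_ ?_)) (and_congr_right ?_)
  · rw [← @Nat.cast_inj ℤ]
    push_cast
    constructor <;> intro h <;> linarith
  · rw [← @Nat.cast_inj ℤ]
    push_cast
    constructor <;> intro h <;> linarith
  · rintro ⟨hs, ht⟩
    set A := a₁ ^ u₁ * b₁ ^ u₂ * (a₂ ^ v₁ * b₂ ^ v₂) with hA
    set B := b₁ ^ u₁ * a₁ ^ u₂ * (b₂ ^ v₁ * a₂ ^ v₂) with hB
    have hBpos : 0 < B := by positivity
    have hV : c ^ s * d ^ t = (A : ℝ) / B := by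
      have e1 : c ^ s * d ^ t =
          (c ^ ((x₁ : ℤ) - x₂) * d ^ ((y₁ : ℤ) - y₂)) ^ ((u₁ : ℤ) - u₂) *
            (c ^ ((e₁ : ℤ) - e₂)) ^ ((v₁ : ℤ) - v₂) := by
        rw [← zpow_natCast c, ← zpow_natCast d, hs, ht, mul_zpow, zpow_add₀ hc.ne', zpow_mul,
          zpow_mul, zpow_mul]
        ring
      have : (0 : ℝ) < a₁ := by exact_mod_cast ha₁
      have : (0 : ℝ) < b₁ := by exact_mod_cast hb₁
      have : (0 : ℝ) < a₂ := by exact_mod_cast ha₂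
      have : (0 : ℝ) < b₂ := by exact_mod_cast hb₂
      rw [e1, h₁, h₂, zpow_sub₀ (by positivity), zpow_sub₀ (by positivity), hA, hB]
      simp only [zpow_natCast, div_pow]
      push_cast
      field_simp
    have hB' : (0 : ℝ) < B := by exact_mod_cast hBpos
    rw [hV, div_le_iff₀ hB', ← sub_lt_iff_lt_add, lt_div_iff₀ hB', sub_mul, one_mul,
      sub_lt_iff_lt_add]
    exact_mod_cast Iff.rfl

/-- A relation certifying that `l/N ≤ m ≤ r/N` forces `m⁻ˢ (1 - m)ᵗ < k < m⁻ˢ (1 - m)ᵗ + 1`. -/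
def StrictCert (s t k N l r : ℕ) : Prop :=
  (N - l) ^ t * N ^ s < k * (l ^ s * N ^ t) ∧
    k * (r ^ s * N ^ t) < (N - r) ^ t * N ^ s + r ^ s * N ^ t

instance (s t k N l r : ℕ) : Decidable (StrictCert s t k N l r) := by
  unfold StrictCert; infer_instance

lemma primrecPred_strictCert {α : Type*} [Primcodable α] {s t k N l r : α → ℕ}
    (hs : Primrec s) (ht : Primrec t) (hk : Primrec k) (hN : Primrec N) (hl : Primrec l)
    (hr : Primrec r) : PrimrecPred fun a => StrictCert (s a) (t a) (k a) (N a) (l a) (r a) := by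
  have pw : ∀ {f g : α → ℕ}, Primrec f → Primrec g → Primrec fun q => f q ^ g q :=
    fun hf hg => primrec_nat_pow.comp hf hg
  have ml : ∀ {f g : α → ℕ}, Primrec f → Primrec g → Primrec fun q => f q * g q :=
    fun hf hg => Primrec.nat_mul.comp hf hg
  have ad : ∀ {f g : α → ℕ}, Primrec f → Primrec g → Primrec fun q => f q + g q :=
    fun hf hg => Primrec.nat_add.comp hf hg
  have sb : ∀ {f g : α → ℕ}, Primrec f → Primrec g → Primrec fun q => f q - g q :=
    fun hf hg => Primrec.nat_sub.comp hf hg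
  refine PrimrecPred.and (Primrec.nat_lt.comp ?_ ?_) (Primrec.nat_lt.comp ?_ ?_)
  · exact ml (pw (sb hN hl) ht) (pw hN hs)
  · exact ml hk (ml (pw hl hs) (pw hN ht))
  · exact ml hk (ml (pw hr hs) (pw hN ht))
  · exact ad (ml (pw (sb hN hr) ht) (pw hN hs)) (ml (pw hr hs) (pw hN ht))

/-- The Boolean version of `RatCert`, with the exponents coded by one number. -/
def ratCheck (x₁ x₂ y₁ y₂ e₁ e₂ a₁ b₁ a₂ b₂ : ℕ) (w : (ℕ × ℕ) × ℕ × ℕ) : Bool :=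
  decide (RatCert x₁ x₂ y₁ y₂ e₁ e₂ a₁ b₁ a₂ b₂ w.1.1 w.1.2 w.2.1 w.2.2.unpair.1.unpair.1
    w.2.2.unpair.1.unpair.2 w.2.2.unpair.2.unpair.1 w.2.2.unpair.2.unpair.2)

lemma primrec_ratCheck (x₁ x₂ y₁ y₂ e₁ e₂ a₁ b₁ a₂ b₂ : ℕ) :
    Primrec (ratCheck x₁ x₂ y₁ y₂ e₁ e₂ a₁ b₁ a₂ b₂) := by
  have hun : Primrec fun w : (ℕ × ℕ) × ℕ × ℕ => w.2.2.unpair :=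
    Primrec.unpair.comp (Primrec.snd.comp Primrec.snd)
  have hu := Primrec.unpair.comp (Primrec.fst.comp hun)
  have hv := Primrec.unpair.comp (Primrec.snd.comp hun)
  exact (primrecPred_ratCert x₁ x₂ y₁ y₂ e₁ e₂ a₁ b₁ a₂ b₂
    (Primrec.fst.comp Primrec.fst) (Primrec.snd.comp Primrec.fst)
    (Primrec.fst.comp Primrec.snd) (Primrec.fst.comp hu) (Primrec.snd.comp hu)
    (Primrec.fst.comp hv) (Primrec.snd.comp hv)).decide

/-- The Boolean version of `StrictCert`, with `N` a power of two. -/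
def strictCheck (w : (ℕ × ℕ) × (ℕ × ℕ) × ℕ × ℕ) : Bool :=
  decide (StrictCert w.1.1 w.1.2 w.2.1.1 (2 ^ w.2.1.2) w.2.2.1 w.2.2.2)

lemma primrec_strictCheck : Primrec strictCheck :=
  (primrecPred_strictCert (Primrec.fst.comp Primrec.fst) (Primrec.snd.comp Primrec.fst)
    (Primrec.fst.comp (Primrec.fst.comp Primrec.snd))
    (primrec_nat_pow.comp (Primrec.const 2) (Primrec.snd.comp (Primrec.fst.comp Primrec.snd)))
    (Primrec.fst.comp (Primrec.snd.comp Primrec.snd))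
    (Primrec.snd.comp (Primrec.snd.comp Primrec.snd))).decide

/-- Truncated subtraction becomes a maximum; it matters because an upper approximation to `m` may
exceed `1`. -/
lemma natCast_sub_div {N r : ℕ} (hN : 0 < N) :
    ((N - r : ℕ) : ℝ) / N = max 0 (1 - (r : ℝ) / N) := by
  have hN' : (0 : ℝ) < N := by exact_mod_cast hN
  rcases le_total r N with h | h
  · rw [Nat.cast_sub h, sub_div, div_self hN'.ne', max_eq_right]
    rw [sub_nonneg, div_le_one hN']
    exact_mod_cast h
  · rw [Nat.sub_eq_zero_of_le h, max_eq_left, Nat.cast_zero, zero_div]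
    rw [sub_nonpos, one_le_div hN']
    exact_mod_cast h

lemma strictCert_iff {N : ℕ} (hN : 0 < N) (s t k l r : ℕ) :
    StrictCert s t k N l r ↔
      (max 0 (1 - (l : ℝ) / N)) ^ t < k * ((l : ℝ) / N) ^ s ∧
      k * ((r : ℝ) / N) ^ s < (max 0 (1 - (r : ℝ) / N)) ^ t + ((r : ℝ) / N) ^ s := by
  have hN' : (0 : ℝ) < N := by exact_mod_cast hN
  have hP : (0 : ℝ) < (N : ℝ) ^ s * (N : ℝ) ^ t := by positivity
  rw [← natCast_sub_div hN, ← natCast_sub_div hN, ← mul_lt_mul_iff_left₀ hP,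
    ← mul_lt_mul_iff_left₀ (b := (k : ℝ) * _) hP]
  have e1 : ∀ z : ℕ, ((z : ℝ) / N) ^ t * ((N : ℝ) ^ s * (N : ℝ) ^ t) =
      ((z ^ t * N ^ s : ℕ) : ℝ) := fun z => by push_cast; rw [div_pow]; field_simp
  have e2 : ∀ z : ℕ, ((z : ℝ) / N) ^ s * ((N : ℝ) ^ s * (N : ℝ) ^ t) =
      ((z ^ s * N ^ t : ℕ) : ℝ) := fun z => by push_cast; rw [div_pow]; field_simp
  rw [add_mul, mul_assoc, mul_assoc, e1, e1, e2, e2, StrictCert]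
  norm_cast

lemma natCeil_eq_iff {V : ℝ} (hV : 0 ≤ V) (k : ℕ) :
    ⌈V⌉₊ = k ↔ V ≤ k ∧ (k : ℝ) < V + 1 := by
  constructor
  · rintro rfl
    exact ⟨Nat.le_ceil V, Nat.ceil_lt_add_one hV⟩
  · rintro ⟨h1, h2⟩
    refine le_antisymm (Nat.ceil_le.2 h1) ?_
    have : (k : ℝ) < ((⌈V⌉₊ + 1 : ℕ) : ℝ) := by
      push_cast
      linarith [Nat.le_ceil V]
    have : k < ⌈V⌉₊ + 1 := by exact_mod_cast this
    omega

/-- Two searches run together. An irrational value is not an integer, so approximations isolate its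
ceiling; a rational value is computed exactly from the hard-coded generators. Each certificate is
sound, so there is no need to decide which case holds, and the generators need not depend computably
on `m`. -/
lemma exists_computable_ceil {m : ℝ} (h : IsComputableReal m) (h0 : 0 < m) (h1 : m < 1) :
    ∃ F : ℕ × ℕ → ℕ, Computable F ∧ ∀ s t, F (s, t) = ⌈(m ^ s)⁻¹ * (1 - m) ^ t⌉₊ := by
  obtain ⟨L, U, hL, hU, hLle, hUle, hLt, hUt⟩ := h.exists_bounds h0.le
  have hc : 0 < m⁻¹ := inv_pos.2 h0
  have hd : 0 < 1 - m := sub_pos.2 h1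
  obtain ⟨x, y, e, hxy, he, hgen⟩ := exists_generators (ratExponents hc.ne' hd.ne')
  obtain ⟨q, hq⟩ := hxy
  obtain ⟨r, hr⟩ := he
  simp only [zpow_zero, mul_one] at hq hr
  obtain ⟨a₁, b₁, ha₁, hb₁, hq'⟩ := exists_nat_div (q := q) (by
    have : (0 : ℝ) < q := hq ▸ mul_pos (zpow_pos hc x) (zpow_pos hd y)
    exact_mod_cast this)
  obtain ⟨a₂, b₂, ha₂, hb₂, hr'⟩ := exists_nat_div (q := r) (by
    have : (0 : ℝ) < r := hr ▸ zpow_pos hc e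
    exact_mod_cast this)
  obtain ⟨x₁, x₂, rfl⟩ := exists_nat_sub x
  obtain ⟨y₁, y₂, rfl⟩ := exists_nat_sub y
  obtain ⟨e₁, e₂, rfl⟩ := exists_nat_sub e
  have hcert := ratCert_iff hc ha₁ hb₁ ha₂ hb₂ (hq.trans hq') (hr.trans hr')
  set R₁ : ℕ × ℕ → ℕ × ℕ → Bool := fun a z => strictCheck (a, z, L z.2, U z.2) with hR₁
  set R₂ : ℕ × ℕ → ℕ × ℕ → Bool := fun a z =>
    ratCheck x₁ x₂ y₁ y₂ e₁ e₂ a₁ b₁ a₂ b₂ (a, z) with hR₂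
  have hR₁c : Computable₂ R₁ := by
    have hz : Computable fun w : (ℕ × ℕ) × ℕ × ℕ => w.2.2 := Computable.snd.comp Computable.snd
    exact primrec_strictCheck.to_comp.comp (Computable.fst.pair
      (Computable.snd.pair ((hL.comp hz).pair (hU.comp hz))))
  have hR₂c : Computable₂ R₂ :=
    (primrec_ratCheck x₁ x₂ y₁ y₂ e₁ e₂ a₁ b₁ a₂ b₂).to_comp.comp
      (Computable.fst.pair Computable.snd)
  have hR : Computable₂ fun a z => R₁ a z || R₂ a z := Primrec.or.to_comp.comp hR₁c hR₂c
  have hV : ∀ s t : ℕ, (m ^ s)⁻¹ * (1 - m) ^ t = m⁻¹ ^ s * (1 - m) ^ t := fun s t => by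
    rw [inv_pow]
  have hmul : ∀ s t : ℕ, ∀ k : ℝ, (m ^ s)⁻¹ * (1 - m) ^ t < k ↔ (1 - m) ^ t < k * m ^ s := by
    intro s t k
    rw [inv_mul_lt_iff₀ (by positivity), mul_comm]
  have hmul' : ∀ s t : ℕ, ∀ k : ℝ,
      k < (m ^ s)⁻¹ * (1 - m) ^ t + 1 ↔ k * m ^ s < (1 - m) ^ t + m ^ s := by
    intro s t k
    rw [← sub_lt_iff_lt_add, lt_inv_mul_iff₀ (by positivity), mul_sub, mul_one,
      sub_lt_iff_lt_add, mul_comm]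
  have hpow2 : ∀ n : ℕ, ((2 ^ n : ℕ) : ℝ) = 2 ^ n := fun n => by push_cast; rfl
  have hex : ∀ a, ∃ z, (R₁ a z || R₂ a z) = true := by
    rintro ⟨s, t⟩
    set V := (m ^ s)⁻¹ * (1 - m) ^ t with hVdef
    have hV0 : 0 < V := by positivity
    obtain ⟨hk1, hk2⟩ := (natCeil_eq_iff hV0.le ⌈V⌉₊).1 rfl
    by_cases hrat : ∃ w : ℚ, V = w
    · obtain ⟨w, hw⟩ := hrat
      obtain ⟨u, v, ht, hs⟩ := hgen s t ⟨w, by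
        simp only [zpow_natCast]
        rw [← hV s t, ← hVdef, hw]⟩
      obtain ⟨u₁, u₂, rfl⟩ := exists_nat_sub u
      obtain ⟨v₁, v₂, rfl⟩ := exists_nat_sub v
      refine ⟨(⌈V⌉₊, Nat.pair (Nat.pair u₁ u₂) (Nat.pair v₁ v₂)), ?_⟩
      rw [Bool.or_eq_true]
      right
      simp only [hR₂, ratCheck, Nat.unpair_pair, decide_eq_true_eq]
      rw [hcert, ← hV s t, ← hVdef]
      exact ⟨⟨hs, ht⟩, hk1, hk2⟩
    -- Both inequalities around the ceiling are now strict, hence survive passing to close enough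
    -- dyadic bounds.
    · have hne : V ≠ ⌈V⌉₊ := fun h => hrat ⟨(⌈V⌉₊ : ℚ), by exact_mod_cast h⟩
      have hlt := lt_of_le_of_ne hk1 hne
      rw [hmul s t] at hlt
      rw [hmul' s t] at hk2
      have hmax : max 0 (1 - m) = 1 - m := max_eq_right hd.le
      have t1 : Tendsto (fun n => (max 0 (1 - (L n : ℝ) / 2 ^ n)) ^ t) atTop
          (𝓝 ((1 - m) ^ t)) := by
        have := ((tendsto_const_nhds (x := (0 : ℝ))).max (hLt.const_sub 1)).pow t
        rwa [hmax] at this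
      have t2 : Tendsto (fun n => (max 0 (1 - (U n : ℝ) / 2 ^ n)) ^ t + ((U n : ℝ) / 2 ^ n) ^ s)
          atTop (𝓝 ((1 - m) ^ t + m ^ s)) := by
        have := (((tendsto_const_nhds (x := (0 : ℝ))).max (hUt.const_sub 1)).pow t).add (hUt.pow s)
        rwa [hmax] at this
      obtain ⟨n, hn1, hn2⟩ := ((t1.eventually_lt ((hLt.pow s).const_mul (⌈V⌉₊ : ℝ)) hlt).and
        (((hUt.pow s).const_mul (⌈V⌉₊ : ℝ)).eventually_lt t2 hk2)).exists
      refine ⟨(⌈V⌉₊, n), ?_⟩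
      rw [Bool.or_eq_true]
      left
      simp only [hR₁, strictCheck, decide_eq_true_eq]
      rw [strictCert_iff (by positivity), hpow2]
      exact ⟨hn1, hn2⟩
  obtain ⟨F, hF, hFe⟩ := exists_computable_of_exists hR hex
  refine ⟨F, hF, fun s t => ?_⟩
  obtain ⟨n, hn⟩ := hFe (s, t)
  symm
  rw [natCeil_eq_iff (by positivity)]
  rw [Bool.or_eq_true] at hn
  rcases hn with hn | hn
  · simp only [hR₁, strictCheck, decide_eq_true_eq] at hn
    rw [strictCert_iff (by positivity), hpow2] at hn
    obtain ⟨hn1, hn2⟩ := hn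
    set k := F (s, t)
    have hl0 : (0 : ℝ) ≤ (L n : ℝ) / 2 ^ n := by positivity
    have hle1 : (1 - m) ^ t ≤ (max 0 (1 - (L n : ℝ) / 2 ^ n)) ^ t :=
      pow_le_pow_left₀ hd.le (le_max_of_le_right (by linarith [hLle n])) t
    have hle2 : ((L n : ℝ) / 2 ^ n) ^ s ≤ m ^ s := pow_le_pow_left₀ hl0 (hLle n) s
    have hle3 : (max 0 (1 - (U n : ℝ) / 2 ^ n)) ^ t ≤ (1 - m) ^ t :=
      pow_le_pow_left₀ (le_max_left _ _) (max_le hd.le (by linarith [hUle n])) t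
    have hle4 : m ^ s ≤ ((U n : ℝ) / 2 ^ n) ^ s := pow_le_pow_left₀ h0.le (hUle n) s
    have hk0 : (0 : ℝ) ≤ k := by positivity
    refine ⟨((hmul s t k).2 ?_).le, (hmul' s t k).2 ?_⟩
    · exact (hle1.trans_lt hn1).trans_le (mul_le_mul_of_nonneg_left hle2 hk0)
    · have hms : 0 < m ^ s := by positivity
      have hdt : 0 < (1 - m) ^ t := by positivity
      -- The inequality reads `(k - 1) m^s < (1 - m)^t`. Replacing the upper bound of `m` by `m`
      -- needs `k - 1` positive; otherwise the claim is immediate.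
      by_cases hk : (k : ℝ) ≤ 1
      · nlinarith
      · push Not at hk
        nlinarith
  · simp only [hR₂, ratCheck, decide_eq_true_eq] at hn
    rw [hcert, ← hV s t] at hn
    exact hn.2

/-! ### Computability of the Champernowne sequence of a Bernoulli measure -/

lemma exists_computable_ceil_minBias {p : unitInterval} (hp : IsComputableReal p) :
    ∃ F : ℕ × ℕ → ℕ, Computable F ∧
      ∀ s t, F (s, t) = ⌈(minBias p ^ s)⁻¹ * (1 - minBias p) ^ t⌉₊ := by
  obtain ⟨d, hd, _, h | ⟨h0, h1⟩⟩ := minBias_cases p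
  · have hc : Primrec fun q : ℕ × ℕ => if q.2 = 0 then 1 else 0 :=
      Primrec.ite (Primrec.eq.comp Primrec.snd (Primrec.const 0)) (Primrec.const 1)
        (Primrec.const 0)
    refine ⟨_, hc.to_comp, fun s t => ?_⟩
    rw [h]
    rcases Nat.eq_zero_or_pos t with rfl | ht
    · simp
    · simp [ht.ne', zero_pow ht.ne']
  · refine exists_computable_ceil ?_ h0 (by linarith)
    rw [← hd]
    cases d
    · simpa [digitProb] using hp.one_sub p.2.1 p.2.2
    · simpa [digitProb] using hp

/-- With `d` the digit of probability `m = minBias p`, the exponent of `w` is the ceiling of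
`m^{-(2l - #d)} (1 - m)^{#(!d)}`, where `#` counts digits in `w`. Since `#d ≤ l`, both exponents are
natural numbers and `exists_computable_ceil_minBias` applies. -/
theorem computable_bernoulliChampernowne {p : unitInterval} (hp : IsComputableReal p)
    {ord : ℕ → List (List Bool)} (hord : IsWordOrdering ord) (hc : Computable ord) :
    Computable (bernoulliChampernowne p ord) := by
  obtain ⟨F, hF, hFe⟩ := exists_computable_ceil_minBias hp
  obtain ⟨d, hd1, hd2, _⟩ := minBias_cases p
  have hm := minBias_pos p
  have hblock : ∀ l, weightedBlock (bernoulliSeq p) ord l ((minBias p ^ (2 * l))⁻¹) =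
      (ord l).flatMap fun w => wpow w (F (2 * l - w.count d, w.count (!d))) := by
    intro l
    rw [weightedBlock]
    refine List.flatMap_congr fun w hw => ?_
    have hle : w.count d ≤ 2 * l := by
      have := ((hord l).2 w).1 hw
      have := List.count_le_length (a := d) (l := w)
      omega
    rw [hFe, bernoulliSeq_real_cyl, prod_map_bool _ d, hd1, hd2, pow_sub₀ _ hm.ne' hle]
    congr 2
    field_simp
  have hG : Computable₂ fun (l : ℕ) (w : List Bool) =>
      wpow w (F (2 * l - w.count d, w.count (!d))) := by
    refine primrec_wpow.to_comp.comp Computable.snd (hF.comp (Computable.pair ?_ ?_))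
    · exact Primrec.nat_sub.to_comp.comp (Primrec.nat_double.to_comp.comp Computable.fst)
        ((primrec_count d).to_comp.comp Computable.snd)
    · exact (primrec_count (!d)).to_comp.comp Computable.snd
  have hB : Computable fun l => (ord l).flatMap fun w =>
      wpow w (F (2 * l - w.count d, w.count (!d))) := computable_list_flatMap hc hG
  have hW : Computable fun k => champWord (bernoulliSeq p) ord
      (fun i => ((minBias p) ^ (2 * i))⁻¹) (fun i => i ^ (2 * i)) k := by
    simp only [champWord, hblock]
    refine computable_list_flatMap Primrec.list_range.to_comp ?_
    have hj : Computable fun q : ℕ × ℕ => q.2 + 1 := Computable.succ.comp Computable.snd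
    exact primrec_wpow.to_comp.comp (hB.comp hj)
      (primrec_nat_pow.to_comp.comp hj (Primrec.nat_double.to_comp.comp hj))
  exact (Primrec.list_getD false).to_comp.comp (hW.comp Computable.succ) Computable.id

end FSDim

end

/-! ### Assembly of the two parts from genericity and computability -/

theorem mainTheorem10 (α : ℝ) (hα : α ∈ Set.Icc (0 : ℝ) 1)
    (ord : ℕ → List (List Bool)) (hord : IsWordOrdering ord) :
    -- every shift-invariant measure with average entropy `α`
    (∀ (b : ℝ) (_ : 1 < b) (μ : Measure BinSeq) (_ : IsProbabilityMeasure μ),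
      MeasurePreserving shift μ μ → upperEntropy μ = α → lowerEntropy μ = α →
        dimFS (champernowne b μ ord) = α ∧
        strongDimFS (champernowne b μ ord) = α ∧
        ∀ k : ℤ, Tendsto (weylAvg (champernowne b μ ord) k) atTop (𝓝 (∫ y, char k y ∂μ))) ∧
    -- computable `α` and Bernoulli measures
    (IsComputableReal α →
      (∃ p : unitInterval, entropy₂ p = α) ∧
      ∀ p : unitInterval, entropy₂ p = α →
        IsComputableReal p ∧
        (Computable ord → Computable (bernoulliChampernowne p ord)) ∧
        dimFS (bernoulliChampernowne p ord) = α ∧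
        strongDimFS (bernoulliChampernowne p ord) = α ∧
        ∀ k : ℤ, Tendsto (weylAvg (bernoulliChampernowne p ord) k) atTop
          (𝓝 (∫ y, char k y ∂(bernoulliSeq p)))) := by
  constructor
  · intro b hb μ _ hμ hu _
    have hg := isGeneric_champernowne hb hord hμ
    obtain ⟨h1, h2⟩ := hg.dim_eq_upperEntropy hμ
    exact ⟨h1.trans hu, h2.trans hu, hg.tendsto_weylAvg⟩
  · intro hc
    refine ⟨exists_entropy₂_eq hα, ?_⟩
    rintro p rfl
    have hp := isComputableReal_of_entropy₂ p.2 hc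
    have hg := isGeneric_bernoulliChampernowne p hord
    obtain ⟨h1, h2⟩ := hg.dim_eq_upperEntropy (measurePreserving_shift_bernoulliSeq p)
    rw [upperEntropy_bernoulliSeq] at h1 h2
    exact ⟨hp, computable_bernoulliChampernowne hp hord, h1, h2, hg.tendsto_weylAvg⟩
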